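/- **Setting.** Let $Y\subset\mathbb R_+$ be a finite set of incomes, $\Phi$ a finite set of signals and $\phi:Y\to\Phi$ a surjective signal function. A consumer lives for $T=2$ periods; her type $\theta_t\in\{l,h\}$ is private, with initial distribution $\pi_l,\pi_h>0$ and transition probabilities $\pi_{ij}$ satisfying $\pi_{ii}>\pi_{ji}$ for $i\neq j$ and $\pi_{hl}>0$. Conditional on the types, incomes are independent and income in period $t$ has distribution $p_{\theta_t}$ on $Y$, where $p_h(y)>0$ for all $y$ and $\sum_y p_l(y)y<\sum_y p_h(y)y$; write $p_h(s)=\sum_{y\in\phi^{-1}(s)}p_h(y)$ for $s\in\Phi$. Let $u:\mathbb R_+\to\mathbb R$ be continuous, twice continuously differentiable on $(0,\infty)$, strictly increasing and strictly concave, and let $\delta\in(0,1)$. For a flow contract $z\in\mathbb R_+^Y$ put $v(z,\theta)=\sum_y p_\theta(y)u(z(y))$ and $\xi(z,\theta)=\sum_y p_\theta(y)(y-z(y))$. A direct mechanism $M$ consists of contracts $z_1(\theta_1)$ and $z_2(s,\theta_1,\theta_2)$, depending on the reports and on the first-period signal $s$. A reporting strategy chooses the first report as a function of $\theta_1$ and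 the second report as a function of the first income, the first report, and both types. $M$ is incentive compatible if truth-telling maximizes the ex-ante expected discounted utility $\mathbb E\sum_t\delta^{t-1}v(z_t,\theta_t)$ over all reporting strategies. For $V=(V_l,V_h)$, $M$ is optimal if it maximizes the expected discounted profit $\mathbb E\sum_t\delta^{t-1}\xi(z_t,\theta_t)$ under truth-telling among incentive compatible mechanisms whose truth-telling utility, conditional on $\theta_1=i$, equals $V_i$ for $i=l,h$. For real $\nu,\Delta$ let $$\chi(\nu,\Delta)=\inf\Big\{\sum_y p_h(y)z(y)\;:\;z\in\mathbb R_+^Y,\ v(z,h)=\nu,\ v(z,l)=\nu-\Delta\Big\},$$ and write $\chi_\nu,\chi_\Delta$ for its partial derivatives. Assume that $\chi$ is supermodular: $\partial^2\chi/\partial\nu\,\partial\Delta$ exists and is $\ge 0$ at every $(\nu,\Delta)$ with $\Delta\ge0$ at which the minimization problem has a solution with $z(y)>0$ for all $y$. **Statement.** Let $V_h>V_l$ and let $M$ be an optimal mechanism for $V$ such that the contracts $z_1(h)$, $z_2(s,h,h)$ and $z_2(s,h,l)$, $s\in\Phi$, have strictly positive consumption at every income level. Put $\nu_1=v(z_1(h),h)$,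 $\Delta_1=\nu_1-v(z_1(h),l)$, $\nu_2(s)=v(z_2(s,h,h),h)$, $\Delta_2(s)=\nu_2(s)-v(z_2(s,h,h),l)$ and $\nu_2^l(s)=v(z_2(s,h,l),l)$. Then $\chi$ is differentiable at $(\nu_1,\Delta_1)$ and at $(\nu_2(s),\Delta_2(s))$ and $(\nu_2^l(s),0)$ for all $s\in\Phi$, and $$\chi_\Delta(\nu_1,\Delta_1)>\sum_{s\in\Phi}p_h(s)\,\chi_\Delta(\nu_2(s),\Delta_2(s)),$$ $$\sum_{s\in\Phi}p_h(s)\,\chi_\nu(\nu_2(s),\Delta_2(s))>\chi_\nu(\nu_1,\Delta_1)>\sum_{s\in\Phi}p_h(s)\,\chi_\nu(\nu_2^l(s),0).$$ -/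

import Mathlib

open scoped NNReal

/-- The two risk types of the consumer: `l` (low) and `h` (high). -/
inductive RiskType where
  | l : RiskType
  | h : RiskType
  deriving DecidableEq

instance : Fintype RiskType where
  elems := {RiskType.l, RiskType.h}
  complete := by intro x; cases x <;> simp

/-- A flow contract: final consumption (nonnegative) for every income level in `Y`. -/
abbrev FlowContract (Y : Finset ℝ≥0) : Type := Y → ℝ≥0

/-- The primitives of the two-period insurance model, with finite income set `Y ⊆ ℝ₊` and
finite signal set `Φ`. -/
structure InsuranceModel (Y : Finset ℝ≥0) (Φ : Type*) where
  /-- income distribution of each type -/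
  p : RiskType → Y → ℝ
  p_nonneg : ∀ θ y, 0 ≤ p θ y
  p_sum : ∀ θ, ∑ y, p θ y = 1
  mean_lt : ∑ y, p RiskType.l y * ((y : ℝ≥0) : ℝ) < ∑ y, p RiskType.h y * ((y : ℝ≥0) : ℝ)
  /-- distribution of the initial type -/
  prior : RiskType → ℝ
  prior_nonneg : ∀ θ, 0 ≤ prior θ
  prior_sum : ∑ θ, prior θ = 1
  /-- `trans i j` is the probability that the next type is `j` when the current type is `i` -/
  trans : RiskType → RiskType → ℝ
  trans_nonneg : ∀ i j, 0 ≤ trans i j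
  trans_sum : ∀ i, ∑ j, trans i j = 1
  persistent : ∀ i j, i ≠ j → trans j i < trans i i
  /-- Bernoulli utility; only its values on `[0, ∞)` matter -/
  u : ℝ → ℝ
  u_continuous : ContinuousOn u (Set.Ici 0)
  u_contDiff : ContDiffOn ℝ 2 u (Set.Ioi 0)
  u_strictMono : StrictMonoOn u (Set.Ici 0)
  u_strictConcave : StrictConcaveOn ℝ (Set.Ici 0) u
  /-- common discount factor -/
  δ : ℝ
  δ_pos : 0 < δ
  δ_lt_one : δ < 1
  /-- signal function -/
  φ : Y → Φ
  φ_surjective : Function.Surjective φ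

/-- A direct mechanism for two periods. `z₁ θ₁` is the flow contract after the first report `θ₁`;
`z₂ s θ₁ θ₂` is the flow contract after first-period signal `s` and reports `θ₁`, `θ₂`. -/
structure DirectMechanism (Y : Finset ℝ≥0) (Φ : Type*) where
  z₁ : RiskType → FlowContract Y
  z₂ : Φ → RiskType → RiskType → FlowContract Y

/-- A reporting strategy. The report in period two depends on the private history
(first income, first report, first type) and on the current type. -/
structure ReportingStrategy (Y : Finset ℝ≥0) where
  r₁ : RiskType → RiskType
  r₂ : Y → RiskType → RiskType → RiskType → RiskType

/-- Truth-telling. -/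
def ReportingStrategy.truthful (Y : Finset ℝ≥0) : ReportingStrategy Y where
  r₁ := fun θ₁ => θ₁
  r₂ := fun _ _ _ θ₂ => θ₂

namespace InsuranceModel

variable {Y : Finset ℝ≥0} {Φ : Type*}

/-- Expected utility `v(z, θ)` of type `θ` from the flow contract `z`. -/
noncomputable def v (E : InsuranceModel Y Φ) (z : FlowContract Y) (θ : RiskType) : ℝ :=
  ∑ y, E.p θ y * E.u (z y)

/-- Expected profit `ξ(z, θ)` from the flow contract `z` with type `θ`. -/
noncomputable def ξ (E : InsuranceModel Y Φ) (z : FlowContract Y) (θ : RiskType) : ℝ :=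
  ∑ y, E.p θ y * (((y : ℝ≥0) : ℝ) - (z y : ℝ))

/-- Probability of the signal `s` for type `θ`. -/
def signalProb [DecidableEq Φ] (E : InsuranceModel Y Φ) (θ : RiskType) (s : Φ) : ℝ :=
  ∑ y, if E.φ y = s then E.p θ y else 0

/-- Discounted expected utility from strategy `r` conditional on the initial type `θ₁`. -/
noncomputable def payoffGiven (E : InsuranceModel Y Φ) (M : DirectMechanism Y Φ)
    (r : ReportingStrategy Y) (θ₁ : RiskType) : ℝ :=
  E.v (M.z₁ (r.r₁ θ₁)) θ₁ +
    E.δ * ∑ y, E.p θ₁ y * ∑ θ₂, E.trans θ₁ θ₂ *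
      E.v (M.z₂ (E.φ y) (r.r₁ θ₁) (r.r₂ y (r.r₁ θ₁) θ₁ θ₂)) θ₂

/-- Ex-ante payoff of the reporting strategy `r`. -/
noncomputable def payoff (E : InsuranceModel Y Φ) (M : DirectMechanism Y Φ)
    (r : ReportingStrategy Y) : ℝ :=
  ∑ θ₁, E.prior θ₁ * E.payoffGiven M r θ₁

/-- Utility `V₁(M | θ₁)` of the initial type `θ₁` under truth-telling. -/
noncomputable def V₁ (E : InsuranceModel Y Φ) (M : DirectMechanism Y Φ) (θ₁ : RiskType) : ℝ :=
  E.payoffGiven M (ReportingStrategy.truthful Y) θ₁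

/-- Incentive compatibility: truth-telling is an optimal reporting strategy. -/
def IncentiveCompatible (E : InsuranceModel Y Φ) (M : DirectMechanism Y Φ) : Prop :=
  ∀ r : ReportingStrategy Y, E.payoff M r ≤ E.payoff M (ReportingStrategy.truthful Y)

/-- Expected discounted profit `Π(M)` under truth-telling. -/
noncomputable def profit (E : InsuranceModel Y Φ) (M : DirectMechanism Y Φ) : ℝ :=
  ∑ θ₁, E.prior θ₁ * (E.ξ (M.z₁ θ₁) θ₁ +
    E.δ * ∑ y, E.p θ₁ y * ∑ θ₂, E.trans θ₁ θ₂ * E.ξ (M.z₂ (E.φ y) θ₁ θ₂) θ₂)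

/-- `M` is feasible for the utility pair `V`: incentive compatible and delivering `V θ` to each
initial type `θ`. -/
def Feasible (E : InsuranceModel Y Φ) (V : RiskType → ℝ) (M : DirectMechanism Y Φ) : Prop :=
  E.IncentiveCompatible M ∧ ∀ θ, E.V₁ M θ = V θ

/-- `M` solves the profit maximization problem for the utility pair `V`. -/
def IsOptimal (E : InsuranceModel Y Φ) (V : RiskType → ℝ) (M : DirectMechanism Y Φ) : Prop :=
  E.Feasible V M ∧ ∀ M', E.Feasible V M' → E.profit M' ≤ E.profit M

/-- Expected consumption cost of the flow contract `z` when provided to the high type. -/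
noncomputable def cost (E : InsuranceModel Y Φ) (z : FlowContract Y) : ℝ :=
  ∑ y, E.p RiskType.h y * (z y : ℝ)

/-- The constraint set of the auxiliary problem at `(ν, Δ)`. -/
def auxFeasible (E : InsuranceModel Y Φ) (ν Δ : ℝ) : Set (FlowContract Y) :=
  {z | E.v z RiskType.h = ν ∧ E.v z RiskType.l = ν - Δ}

/-- The auxiliary cost function `χ(ν, Δ)`. -/
noncomputable def χ (E : InsuranceModel Y Φ) (ν Δ : ℝ) : ℝ :=
  sInf (E.cost '' E.auxFeasible ν Δ)

/-- The marginal cost of flow utility, `∂χ/∂ν`. -/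
noncomputable def χν (E : InsuranceModel Y Φ) (ν Δ : ℝ) : ℝ :=
  deriv (fun n => E.χ n Δ) ν

/-- The marginal cost of distortion, `∂χ/∂Δ`. -/
noncomputable def χΔ (E : InsuranceModel Y Φ) (ν Δ : ℝ) : ℝ :=
  deriv (fun d => E.χ ν d) Δ

/-- The auxiliary problem at `(ν, Δ)` has an interior solution: a cost-minimizing contract with
strictly positive consumption at every income level. -/
def HasInteriorSolution (E : InsuranceModel Y Φ) (ν Δ : ℝ) : Prop :=
  ∃ z ∈ E.auxFeasible ν Δ, (∀ z' ∈ E.auxFeasible ν Δ, E.cost z ≤ E.cost z') ∧ ∀ y, 0 < z y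

/-- Cost supermodularity: `∂²χ/∂ν∂Δ` (exists and) is nonnegative at every `(ν, Δ)` with `Δ ≥ 0`
at which the auxiliary problem has an interior solution. -/
def CostSupermodular (E : InsuranceModel Y Φ) : Prop :=
  ∀ ν Δ : ℝ, 0 ≤ Δ → E.HasInteriorSolution ν Δ →
    DifferentiableAt ℝ (fun d => E.χν ν d) Δ ∧ 0 ≤ deriv (fun d => E.χν ν d) Δ

/-- Flow utility `ν₁` of the contract offered in period one after the report `h`. -/
noncomputable def ν₁ (E : InsuranceModel Y Φ) (M : DirectMechanism Y Φ) : ℝ :=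
  E.v (M.z₁ RiskType.h) RiskType.h

/-- Distortion `Δ₁` of the contract offered in period one after the report `h`. -/
noncomputable def Δ₁ (E : InsuranceModel Y Φ) (M : DirectMechanism Y Φ) : ℝ :=
  E.ν₁ M - E.v (M.z₁ RiskType.h) RiskType.l

/-- Flow utility `ν₂(s)` in period two after the reports `h, h` and the signal `s`. -/
noncomputable def ν₂ (E : InsuranceModel Y Φ) (M : DirectMechanism Y Φ) (s : Φ) : ℝ :=
  E.v (M.z₂ s RiskType.h RiskType.h) RiskType.h

/-- Distortion `Δ₂(s)` in period two after the reports `h, h` and the signal `s`. -/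
noncomputable def Δ₂ (E : InsuranceModel Y Φ) (M : DirectMechanism Y Φ) (s : Φ) : ℝ :=
  E.ν₂ M s - E.v (M.z₂ s RiskType.h RiskType.h) RiskType.l

/-- Flow utility `ν₂ˡ(s)` of the low type in period two after the reports `h, l` and the
signal `s`. -/
noncomputable def ν₂l (E : InsuranceModel Y Φ) (M : DirectMechanism Y Φ) (s : Φ) : ℝ :=
  E.v (M.z₂ s RiskType.h RiskType.l) RiskType.l

end InsuranceModel

/-! Measured in utilities rather than consumption, all constraints on the contracts offered after
the first report `h` are linear, and the cost is convex. Deviations that combine a false first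
report with a false second one need no separate constraint: second-period incentives depend on the
current type only. So the branch after `h` minimizes cost subject to three kinds of constraint: the
promise to type `h`, the deterrence of type `l` with truthful second reports, and the second-period
incentive constraints. Farkas' lemma gives multipliers `lam`, `μ` and `γ`
(`IsOptimal.exists_multipliers`).

The resulting conditions say that each contract for type `h` is stationary for the auxiliary
problem. At an interior stationary contract with multipliers a and b, χ is differentiable with χ_ν =
a - b and χ_Δ = b (`IsStationary.hasFDerivAt_χ`). In period one this gives χ_Δ = μ and χ_ν = lam -
μ. In period two the constraint of type `h` has zero multiplier
(`SecondPeriodConditions.β_eq_zero`), so type `l` is fully insured. Averaging over signals with the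
weights p_h(s) turns the likelihood ratios p_l(s)/p_h(s) into 1, and every expectation becomes a
function of lam, μ and S, the sum of the multipliers of type `l`'s second-period constraints. All
three inequalities then follow from S < μ δ (π_hh - π_lh), using π_ll - π_hl = π_hh - π_lh.

This bound holds signal by signal. If type `l`'s constraint binds, his sure utility is below what
type `h` gets, and supermodularity makes his marginal cost smaller than χ_ν at the distorted
contract (`IsStationary.mc_lt`, `SecondPeriodConditions.α_lt`). Strictness needs μ > 0: with μ = 0
everybody is fully insured after `h` at one consumption level, and type `l` could secure V_h > V_l
by imitation. -/

open Filter Topology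

/-! ### Farkas' lemma and one-sided minima -/

/-- **Farkas' lemma** for finitely many linear functionals on a real vector space. -/
theorem exists_nonneg_combination_of_nonneg {D ι : Type*} [AddCommGroup D] [Module ℝ D]
    (s : Finset ι) (g : ι → D →ₗ[ℝ] ℝ) (f : D →ₗ[ℝ] ℝ)
    (H : ∀ d, (∀ i ∈ s, 0 ≤ g i d) → 0 ≤ f d) :
    ∃ c : ι → ℝ, (∀ i, 0 ≤ c i) ∧ ∀ d, f d = ∑ i ∈ s, c i * g i d := by
  classical
  induction s using Finset.induction_on generalizing g f with
  | empty =>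
    refine ⟨fun _ => 0, fun _ => le_rfl, fun d => ?_⟩
    have h1 := H d (by simp)
    have h2 := H (-d) (by simp)
    rw [map_neg] at h2
    simp only [Finset.sum_empty]
    linarith
  | insert a s ha ih =>
    by_cases hs : ∀ d, (∀ i ∈ s, 0 ≤ g i d) → 0 ≤ f d
    · obtain ⟨c, hc, hf⟩ := ih g f hs
      refine ⟨Function.update c a 0, fun i => ?_, fun d => ?_⟩
      · by_cases hi : i = a
        · subst hi; simp
        · simp [Function.update_of_ne hi, hc i]
      · rw [Finset.sum_insert ha, hf d]
        simp only [Function.update_self, zero_mul, zero_add]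
        refine Finset.sum_congr rfl fun i hi => ?_
        rw [Function.update_of_ne (ne_of_mem_of_not_mem hi ha)]
    · push Not at hs
      obtain ⟨x, hx, hfx⟩ := hs
      have hax : g a x < 0 := by
        by_contra hcon
        push Not at hcon
        refine absurd (H x fun i hi => ?_) (not_le.2 hfx)
        rcases Finset.mem_insert.1 hi with rfl | hi
        exacts [hcon, hx i hi]
      set k : ℝ := (-(g a x))⁻¹ with hk
      have hkpos : 0 < k := inv_pos.2 (by linarith)
      have hkax : k * g a x = -1 := by
        rw [hk]; field_simp [hax.ne]
      -- All functionals are precomposed with the projection d ↦ d + k (g a d) x onto the kernel of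
      -- `g a` along x. There constraint a holds with equality, so the remaining constraints
      -- suffice. Undoing the projection gives the coefficient of `g a`, nonnegative because g i x ≥
      -- 0 and f x < 0.
      obtain ⟨c, hc, hf⟩ := ih (fun i => g i + (k * g i x) • g a) (f + (k * f x) • g a) (by
        intro d hd
        have key : ∀ q : D →ₗ[ℝ] ℝ, (q + (k * q x) • g a) d = q (d + (k * g a d) • x) := by
          intro q
          simp only [LinearMap.add_apply, LinearMap.smul_apply, map_add, map_smul, smul_eq_mul]
          ring
        rw [key]
        refine H _ fun i hi => ?_
        rcases Finset.mem_insert.1 hi with rfl | hi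
        · simp only [map_add, map_smul, smul_eq_mul]
          have : g i d + k * g i d * g i x = 0 := by linear_combination g i d * hkax
          exact this.ge
        · rw [← key]; exact hd i hi)
      refine ⟨Function.update c a (∑ i ∈ s, c i * (k * g i x) - k * f x), fun i => ?_,
        fun d => ?_⟩
      · by_cases hi : i = a
        · subst hi
          simp only [Function.update_self]
          have h1 : 0 ≤ ∑ j ∈ s, c j * (k * g j x) := Finset.sum_nonneg fun j hj =>
            mul_nonneg (hc j) (mul_nonneg hkpos.le (hx j hj))
          nlinarith
        · simp [Function.update_of_ne hi, hc i]
      · rw [Finset.sum_insert ha]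
        have h1 : ∑ i ∈ s, Function.update c a (∑ i ∈ s, c i * (k * g i x) - k * f x) i * g i d
            = ∑ i ∈ s, c i * g i d := by
          refine Finset.sum_congr rfl fun i hi => ?_
          rw [Function.update_of_ne (ne_of_mem_of_not_mem hi ha)]
        rw [h1, Function.update_self]
        have h2 := hf d
        simp only [LinearMap.add_apply, LinearMap.smul_apply, smul_eq_mul, mul_add,
          Finset.sum_add_distrib] at h2
        have h3 : ∑ i ∈ s, c i * (k * g i x * g a d) = (∑ i ∈ s, c i * (k * g i x)) * g a d := by
          rw [Finset.sum_mul]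
          exact Finset.sum_congr rfl fun i _ => by ring
        rw [h3] at h2
        linarith

/-- The derivative at a right-sided minimum is nonnegative. -/
theorem HasDerivAt.nonneg_of_eventually_le_right {f : ℝ → ℝ} {f' a : ℝ} (hf : HasDerivAt f f' a)
    (h : ∀ᶠ t in 𝓝[>] (0 : ℝ), f a ≤ f (a + t)) : 0 ≤ f' := by
  have h1 := (hasDerivAt_iff_tendsto_slope_zero.1 hf).mono_left
    (nhdsWithin_mono (0 : ℝ) (fun x (hx : x ∈ Set.Ioi (0 : ℝ)) => (Set.mem_Ioi.1 hx).ne'))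
  refine ge_of_tendsto h1 ?_
  filter_upwards [h, self_mem_nhdsWithin] with t ht ht0
  have ht0 : 0 < t := ht0
  exact smul_nonneg (inv_nonneg.2 ht0.le) (by linarith)

/-! ### Marginal cost of utility and perturbations of contracts -/

namespace InsuranceModel

variable {Y : Finset ℝ≥0} {Φ : Type*}

/-- The marginal cost of utility at the consumption level `c`. -/
noncomputable def mc (E : InsuranceModel Y Φ) (c : ℝ) : ℝ := (deriv E.u c)⁻¹

theorem contDiffAt_u (E : InsuranceModel Y Φ) {c : ℝ} (hc : 0 < c) : ContDiffAt ℝ 2 E.u c :=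
  E.u_contDiff.contDiffAt (Ioi_mem_nhds hc)

theorem differentiableAt_u (E : InsuranceModel Y Φ) {c : ℝ} (hc : 0 < c) :
    DifferentiableAt ℝ E.u c :=
  (E.contDiffAt_u hc).differentiableAt (by norm_num)

theorem u_strictConcave_pos (E : InsuranceModel Y Φ) :
    StrictConcaveOn ℝ (Set.Ioi 0) E.u :=
  E.u_strictConcave.subset Set.Ioi_subset_Ici_self (convex_Ioi 0)

theorem deriv_u_strictAntiOn (E : InsuranceModel Y Φ) :
    StrictAntiOn (deriv E.u) (Set.Ioi 0) :=
  E.u_strictConcave_pos.strictAntiOn_deriv fun _ hx => E.differentiableAt_u hx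

theorem u_sub_le (E : InsuranceModel Y Φ) {c c' : ℝ} (hc : 0 < c) (hc' : 0 ≤ c') :
    E.u c' - E.u c ≤ deriv E.u c * (c' - c) := by
  have hd := E.differentiableAt_u hc
  rcases lt_trichotomy c c' with h | h | h
  · have h1 := E.u_strictConcave.concaveOn.slope_le_deriv (Set.mem_Ici.2 hc.le)
      (Set.mem_Ici.2 hc') h hd
    rw [slope_def_field, div_le_iff₀ (by linarith)] at h1
    exact h1
  · simp [h]
  · have h1 := E.u_strictConcave.concaveOn.deriv_le_slope (Set.mem_Ici.2 hc')
      (Set.mem_Ici.2 hc.le) h hd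
    rw [slope_def_field, le_div_iff₀ (by linarith)] at h1
    linarith

theorem deriv_u_pos (E : InsuranceModel Y Φ) {c : ℝ} (hc : 0 < c) : 0 < deriv E.u c := by
  have h1 := E.u_sub_le hc (by linarith : (0 : ℝ) ≤ c + 1)
  have h2 := E.u_strictMono (Set.mem_Ici.2 hc.le) (Set.mem_Ici.2 (by linarith : (0 : ℝ) ≤ c + 1))
    (by linarith)
  linarith

theorem mc_strictMonoOn (E : InsuranceModel Y Φ) : StrictMonoOn E.mc (Set.Ioi 0) :=
  fun _ ha _ hb hab =>
    (inv_lt_inv₀ (E.deriv_u_pos ha) (E.deriv_u_pos hb)).2 (E.deriv_u_strictAntiOn ha hb hab)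

theorem mc_continuousOn (E : InsuranceModel Y Φ) : ContinuousOn E.mc (Set.Ioi 0) :=
  (E.u_contDiff.continuousOn_deriv_of_isOpen isOpen_Ioi (by norm_num)).inv₀
    fun _ hx => (E.deriv_u_pos hx).ne'

/-- Tangent inequality for the cost of utility. -/
theorem mc_mul_u_sub_le (E : InsuranceModel Y Φ) {c c' : ℝ} (hc : 0 < c) (hc' : 0 ≤ c') :
    E.mc c * (E.u c' - E.u c) ≤ c' - c := by
  have h1 := E.u_sub_le hc hc'
  have h2 := E.deriv_u_pos hc
  rw [mc, inv_mul_le_iff₀ h2]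
  exact h1

theorem u_lt_of_mc_lt (E : InsuranceModel Y Φ) {c c' : ℝ} (hc : 0 < c) (hc' : 0 < c')
    (h : E.mc c < E.mc c') : E.u c < E.u c' :=
  E.u_strictMono hc.le hc'.le ((E.mc_strictMonoOn.lt_iff_lt hc hc').1 h)

theorem u_le_of_mc_le (E : InsuranceModel Y Φ) {c c' : ℝ} (hc : 0 < c) (hc' : 0 < c')
    (h : E.mc c ≤ E.mc c') : E.u c ≤ E.u c' :=
  E.u_strictMono.monotoneOn hc.le hc'.le ((E.mc_strictMonoOn.le_iff_le hc hc').1 h)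

theorem mc_lt_of_u_lt (E : InsuranceModel Y Φ) {c c' : ℝ} (hc : 0 < c) (hc' : 0 < c')
    (h : E.u c < E.u c') : E.mc c < E.mc c' := by
  by_contra hcon
  exact absurd (E.u_le_of_mc_le hc' hc (not_lt.1 hcon)) (not_le.2 h)

/-- Local inverse of the utility function at an interior consumption level. -/
theorem exists_local_inverse_u (E : InsuranceModel Y Φ) {c : ℝ} (hc : 0 < c) :
    ∃ W : ℝ → ℝ, W 0 = c ∧ HasDerivAt W (E.mc c) 0 ∧ (∀ᶠ t in 𝓝 (0 : ℝ), 0 < W t) ∧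
      ∀ᶠ t in 𝓝 (0 : ℝ), E.u (W t) = E.u c + t := by
  have hs : HasStrictDerivAt E.u (deriv E.u c) c :=
    (E.contDiffAt_u hc).hasStrictDerivAt (by norm_num)
  have hne : deriv E.u c ≠ 0 := (E.deriv_u_pos hc).ne'
  set G := hs.localInverse E.u (deriv E.u c) c hne with hG
  have hG0 : G (E.u c) = c :=
    HasStrictFDerivAt.localInverse_apply_image (hs.hasStrictFDerivAt_equiv hne)
  have hGd : HasDerivAt G (E.mc c) (E.u c + 0) := by
    rw [add_zero]; exact (hs.to_localInverse hne).hasDerivAt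
  have hWd : HasDerivAt (fun t => G (E.u c + t)) (E.mc c) 0 := hGd.comp_const_add (E.u c) 0
  have hW0 : G (E.u c + 0) = c := by rw [add_zero, hG0]
  refine ⟨fun t => G (E.u c + t), hW0, hWd, ?_, ?_⟩
  · exact hWd.continuousAt.eventually (by simp only [hW0]; exact Ioi_mem_nhds hc)
  · have h1 := hs.eventually_right_inverse hne
    have h2 : Tendsto (fun t : ℝ => E.u c + t) (𝓝 0) (𝓝 (E.u c)) := by
      have : Continuous (fun t : ℝ => E.u c + t) := by fun_prop
      simpa using this.tendsto 0
    exact h2.eventually h1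

/-- Perturbations of an interior flow contract, parametrized by the change in utilities. -/
theorem exists_perturbation (E : InsuranceModel Y Φ) {z : FlowContract Y} (hz : ∀ y, 0 < z y) :
    ∃ ζ : (Y → ℝ) → FlowContract Y, ζ 0 = z ∧
      (∀ᶠ x in 𝓝 (0 : Y → ℝ), ∀ θ, E.v (ζ x) θ = E.v z θ + ∑ y, E.p θ y * x y) ∧
      ∀ y, HasFDerivAt (fun x => (ζ x y : ℝ))
        (E.mc (z y) • (ContinuousLinearMap.proj y : (Y → ℝ) →L[ℝ] ℝ)) 0 := by
  choose W hW0 hWd hWpos hWu using fun y => E.exists_local_inverse_u (NNReal.coe_pos.2 (hz y))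
  have hproj : ∀ y : Y, Tendsto (fun x : Y → ℝ => x y) (𝓝 0) (𝓝 0) := fun y => by
    simpa using (continuous_apply y).tendsto (0 : Y → ℝ)
  have hpos : ∀ᶠ x in 𝓝 (0 : Y → ℝ), ∀ y, 0 < W y (x y) :=
    eventually_all.2 fun y => (hproj y).eventually (hWpos y)
  have hu : ∀ᶠ x in 𝓝 (0 : Y → ℝ), ∀ y, E.u (W y (x y)) = E.u (z y) + x y :=
    eventually_all.2 fun y => (hproj y).eventually (hWu y)
  refine ⟨fun x y => (W y (x y)).toNNReal, ?_, ?_, fun y => ?_⟩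
  · funext y
    simp [hW0]
  · filter_upwards [hpos, hu] with x hx hux θ
    simp only [v]
    rw [← Finset.sum_add_distrib]
    refine Finset.sum_congr rfl fun y _ => ?_
    rw [Real.coe_toNNReal _ (hx y).le, hux y]
    ring
  · have h1 : HasFDerivAt (fun x : Y → ℝ => W y (x y))
        (E.mc (z y) • (ContinuousLinearMap.proj y : (Y → ℝ) →L[ℝ] ℝ)) 0 := by
      have h2 : HasDerivAt (W y) (E.mc (z y)) ((0 : Y → ℝ) y) := by simpa using hWd y
      exact h2.comp_hasFDerivAt (0 : Y → ℝ)
        (ContinuousLinearMap.proj (R := ℝ) (φ := fun _ : Y => ℝ) y).hasFDerivAt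
    refine h1.congr_of_eventuallyEq ?_
    filter_upwards [hpos] with x hx
    exact Real.coe_toNNReal _ (hx y).le

/-- An interior flow contract has an interior certainty equivalent. -/
theorem exists_certainty_equivalent (E : InsuranceModel Y Φ) {z : FlowContract Y}
    (hz : ∀ y, 0 < z y) (θ : RiskType) : ∃ c : ℝ, 0 < c ∧ E.u c = E.v z θ := by
  have hcvx : Convex ℝ (E.u '' Set.Ioi 0) := by
    refine Set.OrdConnected.convex (IsPreconnected.ordConnected ?_)
    exact isPreconnected_Ioi.image _ (E.u_continuous.mono Set.Ioi_subset_Ici_self)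
  obtain ⟨c, hc, hcv⟩ : E.v z θ ∈ E.u '' Set.Ioi 0 := by
    have := hcvx.sum_mem (t := Finset.univ) (w := E.p θ) (z := fun y => E.u (z y))
      (fun y _ => E.p_nonneg θ y) (E.p_sum θ)
      (fun y _ => ⟨z y, NNReal.coe_pos.2 (hz y), rfl⟩)
    simpa [v] using this
  exact ⟨c, hc, hcv⟩

/-- If the marginal cost of utility is decreasing in the likelihood ratio of `θ'` and `θ`, then
the contract is worse for `θ'` than for `θ`. -/
theorem v_lt_of_mc_eq (E : InsuranceModel Y Φ) {z : FlowContract Y} (hz : ∀ y, 0 < z y)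
    {θ θ' : RiskType} (hne : θ ≠ θ') {a b : ℝ} (hb : 0 < b)
    (h : ∀ y, E.p θ y * E.mc (z y) = a * E.p θ y - b * E.p θ' y) : E.v z θ' < E.v z θ := by
  -- Centring at the certainty equivalent of θ eliminates a: the θ-expectation of the product of the
  -- deviations of marginal cost and of utility equals b (v(z,θ) - v(z,θ')). It is nonnegative
  -- because both deviations have the same sign.
  obtain ⟨c, hc, hcv⟩ := E.exists_certainty_equivalent hz θ
  have hzc : ∀ y, (0 : ℝ) < z y := fun y => NNReal.coe_pos.2 (hz y)
  have hterm : ∀ y, 0 ≤ E.p θ y * ((E.mc (z y) - E.mc c) * (E.u (z y) - E.u c)) := by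
    intro y
    refine mul_nonneg (E.p_nonneg θ y) ?_
    rcases le_total (E.u (z y)) (E.u c) with h1 | h1
    · have h2 : E.mc (z y) ≤ E.mc c := by
        rcases h1.lt_or_eq with h1 | h1
        · exact (E.mc_lt_of_u_lt (hzc y) hc h1).le
        · rw [E.u_strictMono.injOn (hzc y).le hc.le h1]
      nlinarith
    · have h2 : E.mc c ≤ E.mc (z y) := by
        rcases h1.lt_or_eq with h1 | h1
        · exact (E.mc_lt_of_u_lt hc (hzc y) h1).le
        · rw [E.u_strictMono.injOn (hzc y).le hc.le h1.symm]
      nlinarith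
  have hsum : ∑ y, E.p θ y * ((E.mc (z y) - E.mc c) * (E.u (z y) - E.u c)) =
      b * (E.v z θ - E.v z θ') := by
    have h1 : ∀ y, E.p θ y * ((E.mc (z y) - E.mc c) * (E.u (z y) - E.u c)) =
        (a - E.mc c) * (E.p θ y * E.u (z y)) - (a - E.mc c) * E.u c * E.p θ y
          - b * (E.p θ' y * E.u (z y)) + b * E.u c * E.p θ' y := by
      intro y
      linear_combination (E.u (z y) - E.u c) * h y
    simp only [h1, Finset.sum_add_distrib, Finset.sum_sub_distrib, ← Finset.mul_sum, E.p_sum]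
    rw [hcv]
    simp only [v]
    ring_nf
  have hnn := Finset.sum_nonneg fun y (_ : y ∈ Finset.univ) => hterm y
  rcases hnn.lt_or_eq with hlt | heq
  · rw [hsum] at hlt
    have := (mul_pos_iff_of_pos_left hb).1 hlt
    linarith
  -- If the expectation vanishes, marginal cost is constant on the support of θ, which forces the
  -- two income distributions to coincide and contradicts the ranking of the means.
  · exfalso
    have hzero := (Finset.sum_eq_zero_iff_of_nonneg fun y (_ : y ∈ Finset.univ) => hterm y).1
      heq.symm
    have h2 : ∀ y, b * E.p θ' y = (a - E.mc c) * E.p θ y := by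
      intro y
      rcases (E.p_nonneg θ y).lt_or_eq with hp | hp
      · have h3 : E.mc (z y) = E.mc c := by
          by_contra hcon
          have h4 := hzero y (Finset.mem_univ y)
          rcases mul_eq_zero.1 h4 with h4 | h4
          · exact hp.ne' h4
          · rcases mul_eq_zero.1 h4 with h4 | h4
            · exact hcon (by linarith)
            · exact hcon (by rw [E.u_strictMono.injOn (hzc y).le hc.le (by linarith)])
        have := h y
        rw [h3] at this
        linarith
      · have := h y
        rw [← hp] at this ⊢
        linarith
    have h3 : b = a - E.mc c := by
      have := Finset.sum_congr (rfl : (Finset.univ : Finset Y) = Finset.univ) fun y _ => h2 y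
      rwa [← Finset.mul_sum, ← Finset.mul_sum, E.p_sum, E.p_sum, mul_one, mul_one] at this
    have h4 : ∀ y, E.p θ' y = E.p θ y := fun y => by
      have := h2 y
      rw [← h3] at this
      exact mul_left_cancel₀ hb.ne' this
    have hm := E.mean_lt
    cases θ <;> cases θ' <;> simp_all
end InsuranceModel

/-- A strictly increasing continuous function on a compact interval has an inverse that extends to
a continuous function on the line. -/
theorem exists_continuous_inverse_Icc {f : ℝ → ℝ} {c d : ℝ} (hcd : c ≤ d)
    (hf : StrictMonoOn f (Set.Icc c d)) (hfc : ContinuousOn f (Set.Icc c d)) :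
    ∃ G : ℝ → ℝ, Continuous G ∧ (∀ m, G m ∈ Set.Icc c d) ∧
      ∀ m ∈ Set.Icc (f c) (f d), f (G m) = m := by
  have himg : f '' Set.Icc c d = Set.Icc (f c) (f d) :=
    Set.Subset.antisymm
      (by
        rintro _ ⟨x, hx, rfl⟩
        exact ⟨hf.monotoneOn (Set.left_mem_Icc.2 hcd) hx hx.1,
          hf.monotoneOn hx (Set.right_mem_Icc.2 hcd) hx.2⟩)
      (intermediate_value_Icc hcd hfc)
  have hle : f c ≤ f d := hf.monotoneOn (Set.left_mem_Icc.2 hcd) (Set.right_mem_Icc.2 hcd) hcd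
  let e : Set.Icc c d ≃o Set.Icc (f c) (f d) :=
    (hf.orderIso f (Set.Icc c d)).trans (OrderIso.setCongr _ _ himg)
  have he : ∀ x, (e x : ℝ) = f x := fun x => rfl
  refine ⟨Set.IccExtend hle fun m => (e.symm m : ℝ), ?_, fun m => ?_, fun m hm => ?_⟩
  · exact (continuous_subtype_val.comp e.symm.continuous).Icc_extend'
  · exact (e.symm (Set.projIcc _ _ hle m)).2
  · rw [Set.IccExtend_of_mem hle _ hm, ← he, OrderIso.apply_symm_apply]

/-! ### The auxiliary problem: derivatives of χ and supermodularity -/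

namespace InsuranceModel

variable {Y : Finset ℝ≥0} {Φ : Type*}

/-- First-order condition of the auxiliary problem with multipliers `a` and `b` at an interior
contract. -/
structure IsStationary (E : InsuranceModel Y Φ) (z : FlowContract Y) (a b : ℝ) : Prop where
  pos : ∀ y, 0 < z y
  eq : ∀ y, E.p RiskType.h y * E.mc (z y) = a * E.p RiskType.h y - b * E.p RiskType.l y

namespace IsStationary

variable {E : InsuranceModel Y Φ} {z : FlowContract Y} {a b : ℝ}

/-- Consumption is a convex function of utility with slope `mc`. Weighting its tangent inequalities
by p_h and inserting the first-order condition gives an affine function of (ν, Δ) that supports the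
cost from below. -/
theorem le_cost (hz : E.IsStationary z a b) (z' : FlowContract Y) :
    E.cost z + ((a - b) * (E.v z' RiskType.h - E.v z RiskType.h) +
      b * ((E.v z' RiskType.h - E.v z' RiskType.l) - (E.v z RiskType.h - E.v z RiskType.l)))
      ≤ E.cost z' := by
  have h1 : ∀ y, E.p RiskType.h y * (z y : ℝ) +
      (a * (E.p RiskType.h y * E.u (z' y)) - a * (E.p RiskType.h y * E.u (z y))
        - b * (E.p RiskType.l y * E.u (z' y)) + b * (E.p RiskType.l y * E.u (z y)))
      ≤ E.p RiskType.h y * (z' y : ℝ) := by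
    intro y
    have h2 := E.mc_mul_u_sub_le (NNReal.coe_pos.2 (hz.pos y)) (z' y).2
    have h3 := mul_le_mul_of_nonneg_left h2 (E.p_nonneg RiskType.h y)
    have h4 := hz.eq y
    have h5 : E.p RiskType.h y * (E.mc (z y) * (E.u (z' y) - E.u (z y))) =
        a * (E.p RiskType.h y * E.u (z' y)) - a * (E.p RiskType.h y * E.u (z y))
        - b * (E.p RiskType.l y * E.u (z' y)) + b * (E.p RiskType.l y * E.u (z y)) := by
      linear_combination (E.u (z' y) - E.u (z y)) * h4
    have h6 : ((z' y).val : ℝ) = (z' y : ℝ) := rfl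
    rw [← h5]
    rw [h6] at h3
    linarith
  have h2 := Finset.sum_le_sum fun y (_ : y ∈ Finset.univ) => h1 y
  simp only [Finset.sum_add_distrib, Finset.sum_sub_distrib, ← Finset.mul_sum] at h2
  simp only [cost, v]
  linarith

theorem isLeast_cost (hz : E.IsStationary z a b) {ν Δ : ℝ} (hν : E.v z RiskType.h = ν)
    (hΔ : E.v z RiskType.l = ν - Δ) : IsLeast (E.cost '' E.auxFeasible ν Δ) (E.cost z) := by
  refine ⟨⟨z, ⟨hν, hΔ⟩, rfl⟩, ?_⟩
  rintro _ ⟨z', ⟨h1, h2⟩, rfl⟩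
  have := hz.le_cost z'
  rw [h1, h2, hν, hΔ] at this
  linarith

theorem hasInteriorSolution (hz : E.IsStationary z a b) {ν Δ : ℝ} (hν : E.v z RiskType.h = ν)
    (hΔ : E.v z RiskType.l = ν - Δ) : E.HasInteriorSolution ν Δ :=
  ⟨z, ⟨hν, hΔ⟩, fun z' hz' => (hz.isLeast_cost hν hΔ).2 ⟨z', hz', rfl⟩, hz.pos⟩

/-- An envelope argument by sandwiching: near (ν, Δ), χ lies above the affine support of `le_cost`
and below the cost of an explicit feasible perturbation of z. Both agree with χ at the point and
have the same derivative there. -/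
theorem hasFDerivAt_χ (hz : E.IsStationary z a b) {ν Δ : ℝ} (hν : E.v z RiskType.h = ν)
    (hΔ : E.v z RiskType.l = ν - Δ) :
    HasFDerivAt (fun q : ℝ × ℝ => E.χ q.1 q.2)
      ((a - b) • ContinuousLinearMap.fst ℝ ℝ ℝ + b • ContinuousLinearMap.snd ℝ ℝ ℝ) (ν, Δ) := by
  obtain ⟨ζ, hζ0, hζv, hζd⟩ := E.exists_perturbation hz.pos
  set mh := ∑ y, E.p RiskType.h y * ((y : ℝ≥0) : ℝ) with hmh
  set ml := ∑ y, E.p RiskType.l y * ((y : ℝ≥0) : ℝ) with hml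
  have hm : mh - ml ≠ 0 := (sub_pos.2 E.mean_lt).ne'
  -- A utility direction with p_h-mean 0 and p_l-mean -1, available because mean incomes differ: it
  -- raises the distortion and leaves type `h`'s utility fixed. Constant directions move ν alone.
  let e : Y → ℝ := fun y => (((y : ℝ≥0) : ℝ) - mh) / (mh - ml)
  have heh : ∑ y, E.p RiskType.h y * e y = 0 := by
    have h1 : ∀ y, E.p RiskType.h y * e y =
        (E.p RiskType.h y * ((y : ℝ≥0) : ℝ) - mh * E.p RiskType.h y) / (mh - ml) := fun y => by
      simp only [e]; ring
    simp only [h1, ← Finset.sum_div, Finset.sum_sub_distrib, ← Finset.mul_sum, E.p_sum]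
    rw [← hmh]; simp
  have hel : ∑ y, E.p RiskType.l y * e y = -1 := by
    have h1 : ∀ y, E.p RiskType.l y * e y =
        (E.p RiskType.l y * ((y : ℝ≥0) : ℝ) - mh * E.p RiskType.l y) / (mh - ml) := fun y => by
      simp only [e]; ring
    simp only [h1, ← Finset.sum_div, Finset.sum_sub_distrib, ← Finset.mul_sum, E.p_sum]
    rw [← hml]; field_simp; ring
  let D : ℝ × ℝ →L[ℝ] (Y → ℝ) := ContinuousLinearMap.pi fun y =>
    ContinuousLinearMap.fst ℝ ℝ ℝ + e y • ContinuousLinearMap.snd ℝ ℝ ℝ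
  have hD : ∀ q y, D q y = q.1 + e y * q.2 := fun q y => by simp [D]
  have hDh : ∀ q, ∑ y, E.p RiskType.h y * D q y = q.1 := fun q => by
    simp only [hD, mul_add, Finset.sum_add_distrib, ← Finset.sum_mul, E.p_sum, ← mul_assoc, heh]
    ring
  have hDl : ∀ q, ∑ y, E.p RiskType.l y * D q y = q.1 - q.2 := fun q => by
    simp only [hD, mul_add, Finset.sum_add_distrib, ← Finset.sum_mul, E.p_sum, ← mul_assoc, hel]
    ring
  let g : ℝ × ℝ → (Y → ℝ) := fun q => D (q - (ν, Δ))
  have hg0 : g (ν, Δ) = 0 := by simp [g]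
  have hgd : HasFDerivAt g D (ν, Δ) := by
    have h1 : HasFDerivAt (fun q : ℝ × ℝ => q - (ν, Δ)) (ContinuousLinearMap.id ℝ (ℝ × ℝ)) (ν, Δ) :=
      (hasFDerivAt_id _).sub_const _
    exact D.hasFDerivAt.comp (ν, Δ) h1
  have hU : HasFDerivAt (fun q => E.cost (ζ (g q)))
      ((a - b) • ContinuousLinearMap.fst ℝ ℝ ℝ + b • ContinuousLinearMap.snd ℝ ℝ ℝ) (ν, Δ) := by
    have h1 : ∀ y, HasFDerivAt (fun q => E.p RiskType.h y * (ζ (g q) y : ℝ))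
        (E.p RiskType.h y • ((E.mc (z y) •
          (ContinuousLinearMap.proj y : (Y → ℝ) →L[ℝ] ℝ)).comp D)) (ν, Δ) := by
      intro y
      have h2 := hζd y
      rw [← hg0] at h2
      exact (h2.comp (ν, Δ) hgd).const_mul _
    have h3 := HasFDerivAt.fun_sum fun y (_ : y ∈ Finset.univ) => h1 y
    refine h3.congr_fderiv ?_
    ext
    all_goals
      simp only [sum_apply, smul_apply,
        ContinuousLinearMap.comp_apply, add_apply,
        ContinuousLinearMap.proj_apply, ContinuousLinearMap.coe_fst', ContinuousLinearMap.coe_snd',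
        ContinuousLinearMap.inl_apply, ContinuousLinearMap.inr_apply, smul_eq_mul]
      have h4 : ∀ q : ℝ × ℝ, ∑ y, E.p RiskType.h y * (E.mc (z y) * D q y) =
          (a - b) * q.1 + b * q.2 := by
        intro q
        have h5 : ∀ y, E.p RiskType.h y * (E.mc (z y) * D q y) =
            a * (E.p RiskType.h y * D q y) - b * (E.p RiskType.l y * D q y) := fun y => by
          linear_combination D q y * hz.eq y
        simp only [h5, Finset.sum_sub_distrib, ← Finset.mul_sum, hDh, hDl]
        ring
      rw [h4]
  have hχ0 : E.χ ν Δ = E.cost z := (hz.isLeast_cost hν hΔ).csInf_eq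
  have hU0 : E.cost (ζ (g (ν, Δ))) = E.cost z := by rw [hg0, hζ0]
  refine HasFDerivAt.of_isLittleO ?_
  -- The remainder of χ lies between 0 and the remainder of the upper bound.
  refine Asymptotics.IsBigO.trans_isLittleO ?_ hU.isLittleO
  have hgt : Tendsto g (𝓝 (ν, Δ)) (𝓝 0) := by
    simpa only [hg0] using hgd.continuousAt.tendsto
  refine Asymptotics.IsBigO.of_bound 1 ?_
  filter_upwards [hgt.eventually hζv] with q hq
  have hfeas : ζ (g q) ∈ E.auxFeasible q.1 q.2 := by
    constructor
    · rw [hq, hDh, hν]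
      simp
    · rw [hq, hDl, hΔ]
      simp only [Prod.fst_sub, Prod.snd_sub]
      ring
  have hlow : ∀ x ∈ E.cost '' E.auxFeasible q.1 q.2,
      E.cost z + ((a - b) * (q.1 - ν) + b * (q.2 - Δ)) ≤ x := by
    rintro _ ⟨z', ⟨h1, h2⟩, rfl⟩
    have := hz.le_cost z'
    rw [h1, h2, hν, hΔ] at this
    linarith
  have hle1 : E.cost z + ((a - b) * (q.1 - ν) + b * (q.2 - Δ)) ≤ E.χ q.1 q.2 :=
    le_csInf ⟨_, ζ (g q), hfeas, rfl⟩ hlow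
  have hle2 : E.χ q.1 q.2 ≤ E.cost (ζ (g q)) := csInf_le ⟨_, hlow⟩ ⟨_, hfeas, rfl⟩
  simp only [smul_apply, add_apply,
    ContinuousLinearMap.coe_fst', ContinuousLinearMap.coe_snd', smul_eq_mul, Prod.fst_sub,
    Prod.snd_sub, hχ0, hU0, one_mul, Real.norm_eq_abs]
  rw [abs_of_nonneg (by linarith), abs_of_nonneg (by linarith)]
  linarith

theorem χν_eq (hz : E.IsStationary z a b) {ν Δ : ℝ} (hν : E.v z RiskType.h = ν)
    (hΔ : E.v z RiskType.l = ν - Δ) : E.χν ν Δ = a - b := by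
  have h1 : HasFDerivAt (fun q : ℝ × ℝ => E.χ q.1 q.2) _ ((fun n : ℝ => (n, Δ)) ν) :=
    hz.hasFDerivAt_χ hν hΔ
  have h2 := h1.comp_hasDerivAt ν ((hasDerivAt_id ν).prodMk (hasDerivAt_const ν Δ))
  refine (HasDerivAt.deriv h2).trans ?_
  simp

theorem χΔ_eq (hz : E.IsStationary z a b) {ν Δ : ℝ} (hν : E.v z RiskType.h = ν)
    (hΔ : E.v z RiskType.l = ν - Δ) : E.χΔ ν Δ = b := by
  have h1 : HasFDerivAt (fun q : ℝ × ℝ => E.χ q.1 q.2) _ ((fun d : ℝ => (ν, d)) Δ) :=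
    hz.hasFDerivAt_χ hν hΔ
  have h2 := h1.comp_hasDerivAt Δ ((hasDerivAt_const Δ ν).prodMk (hasDerivAt_id Δ))
  refine (HasDerivAt.deriv h2).trans ?_
  simp

end IsStationary

/-- Full insurance at consumption level `c` is stationary, with marginal cost of utility `mc c`. -/
theorem isStationary_const (E : InsuranceModel Y Φ) {c : ℝ} (hc : 0 < c) :
    E.IsStationary (fun _ => c.toNNReal) (E.mc c) 0 where
  pos _ := Real.toNNReal_pos.2 hc
  eq y := by rw [Real.coe_toNNReal _ hc.le]; ring

theorem v_const (E : InsuranceModel Y Φ) {c : ℝ} (hc : 0 < c) (θ : RiskType) :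
    E.v (fun _ => c.toNNReal) θ = E.u c := by
  simp only [v, Real.coe_toNNReal _ hc.le, ← Finset.sum_mul, E.p_sum, one_mul]

/-- Below an interior solution with nonnegative distortion, every smaller distortion has an
interior solution at the same flow utility. -/
theorem IsStationary.hasInteriorSolution_of_le {E : InsuranceModel Y Φ} {z : FlowContract Y}
    {a b : ℝ} (hz : E.IsStationary z a b) (hp : ∀ y, 0 < E.p RiskType.h y) (hb : 0 < b) {d : ℝ}
    (hd : d ∈ Set.Icc 0 (E.v z RiskType.h - E.v z RiskType.l)) :
    E.HasInteriorSolution (E.v z RiskType.h) d := by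
  have hne : (Finset.univ : Finset Y).Nonempty := by
    rw [Finset.nonempty_iff_ne_empty]
    intro h
    have := E.p_sum RiskType.h
    rw [h] at this
    simp at this
  -- The candidates have marginal cost s - β ℓ(y), with ℓ the likelihood ratio. Lowering β from b to
  -- 0, with s adjusted to keep type `h`'s utility, leads from z to full insurance. The distortion
  -- varies continuously along this path, hence takes every intermediate value.
  set ℓ : Y → ℝ := fun y => E.p RiskType.l y / E.p RiskType.h y with hℓ
  have hℓ0 : ∀ y, 0 ≤ ℓ y := fun y => div_nonneg (E.p_nonneg _ y) (hp y).le
  have hpℓ : ∀ y, E.p RiskType.h y * ℓ y = E.p RiskType.l y := fun y => by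
    simp only [hℓ]; field_simp [(hp y).ne']
  have hmc : ∀ y, E.mc (z y) = a - b * ℓ y := fun y => by
    refine mul_left_cancel₀ (hp y).ne' ?_
    rw [hz.eq y, ← hpℓ]; ring
  obtain ⟨y₁, -, hy₁⟩ := Finset.exists_max_image Finset.univ ℓ hne
  obtain ⟨y₂, -, hy₂⟩ := Finset.exists_min_image Finset.univ ℓ hne
  have hy₁ : ∀ y, ℓ y ≤ ℓ y₁ := fun y => hy₁ y (Finset.mem_univ y)
  have hy₂ : ∀ y, ℓ y₂ ≤ ℓ y := fun y => hy₂ y (Finset.mem_univ y)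
  have hzc : ∀ y, (0 : ℝ) < z y := fun y => NNReal.coe_pos.2 (hz.pos y)
  have hzle : ∀ y y', ℓ y ≤ ℓ y' → (z y' : ℝ) ≤ z y := fun y y' h => by
    refine (E.mc_strictMonoOn.le_iff_le (hzc y') (hzc y)).1 ?_
    rw [hmc, hmc]; nlinarith
  have hsub : Set.Icc (z y₁ : ℝ) (z y₂) ⊆ Set.Ioi 0 := fun x hx => (hzc y₁).trans_le hx.1
  obtain ⟨G, hGc, hGmem, hGinv⟩ := exists_continuous_inverse_Icc (hzle y₂ y₁ (hy₁ y₂))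
    (E.mc_strictMonoOn.mono hsub) (E.mc_continuousOn.mono hsub)
  have hGpos : ∀ m, 0 < G m := fun m => hsub (hGmem m)
  rw [hmc, hmc] at hGinv
  set I := Set.Icc (a - b * ℓ y₁) (a - b * ℓ y₂) with hI
  set f : ℝ → ℝ := fun m => E.u (G m) with hf
  have hfc : Continuous f := by
    refine continuous_iff_continuousAt.2 fun m => ?_
    exact (E.differentiableAt_u (hGpos m)).continuousAt.comp hGc.continuousAt
  have hfmono : StrictMonoOn f I := fun m hm m' hm' h =>
    E.u_lt_of_mc_lt (hGpos m) (hGpos m') (by rwa [hGinv m hm, hGinv m' hm'])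
  have hGz : ∀ y, G (a - b * ℓ y) = z y := fun y => by
    refine E.mc_strictMonoOn.injOn (hGpos _) (hzc y) ?_
    rw [hGinv, hmc]
    exact ⟨by nlinarith [hy₁ y], by nlinarith [hy₂ y]⟩
  have hfz : ∀ θ, ∑ y, E.p θ y * f (a - b * ℓ y) = E.v z θ := fun θ => by
    simp only [v, hf, hGz]
  have hmem : ∀ β ∈ Set.Icc 0 b, ∀ s ∈ Set.Icc (a - (b - β) * ℓ y₁) (a - (b - β) * ℓ y₂), ∀ y,
      s - β * ℓ y ∈ I := fun β hβ s hs y =>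
    ⟨by nlinarith [hy₁ y, hs.1, hβ.1], by nlinarith [hy₂ y, hs.2, hβ.1]⟩
  have hbI : ∀ y, a - b * ℓ y ∈ I := fun y =>
    ⟨by nlinarith [hy₁ y], by nlinarith [hy₂ y]⟩
  -- On this interval for s, marginal costs stay within the range attained by z, so consumption
  -- stays positive. At the endpoints the contract is pointwise below, respectively above, z, and
  -- the intermediate value theorem applies.
  have hlevel : ∀ β, ∃ s, β ∈ Set.Icc 0 b →
      s ∈ Set.Icc (a - (b - β) * ℓ y₁) (a - (b - β) * ℓ y₂) ∧
      ∑ y, E.p RiskType.h y * f (s - β * ℓ y) = E.v z RiskType.h := by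
    intro β
    by_cases hβ : β ∈ Set.Icc 0 b
    swap
    · exact ⟨0, fun h => absurd h hβ⟩
    have hle : a - (b - β) * ℓ y₁ ≤ a - (b - β) * ℓ y₂ := by nlinarith [hy₁ y₂, hβ.2]
    have hcont : Continuous fun s => ∑ y, E.p RiskType.h y * f (s - β * ℓ y) := by fun_prop
    have hivt := intermediate_value_Icc hle hcont.continuousOn
    have hin : E.v z RiskType.h ∈ Set.Icc
        (∑ y, E.p RiskType.h y * f (a - (b - β) * ℓ y₁ - β * ℓ y))
        (∑ y, E.p RiskType.h y * f (a - (b - β) * ℓ y₂ - β * ℓ y)) := by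
      rw [← hfz]
      constructor
      · refine Finset.sum_le_sum fun y _ => mul_le_mul_of_nonneg_left ?_ (hp y).le
        refine hfmono.monotoneOn (hmem β hβ _ ⟨le_rfl, hle⟩ y) (hbI y) ?_
        nlinarith [hy₁ y, hβ.2]
      · refine Finset.sum_le_sum fun y _ => mul_le_mul_of_nonneg_left ?_ (hp y).le
        refine hfmono.monotoneOn (hbI y) (hmem β hβ _ ⟨hle, le_rfl⟩ y) ?_
        nlinarith [hy₂ y, hβ.2]
    obtain ⟨s, hs, hs'⟩ := hivt hin
    exact ⟨s, fun _ => ⟨hs, hs'⟩⟩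
  choose s hs using hlevel
  -- Contracts giving type `h` the same utility cannot have pointwise strictly ordered marginal
  -- costs. This makes s Lipschitz in β, with constant the largest likelihood ratio.
  have hcmp : ∀ β ∈ Set.Icc 0 b, ∀ β' ∈ Set.Icc 0 b,
      ¬ ∀ y, s β - β * ℓ y < s β' - β' * ℓ y := by
    intro β hβ β' hβ' h
    have h1 := (hs β hβ).2
    rw [← (hs β' hβ').2] at h1
    refine absurd h1 (ne_of_lt (Finset.sum_lt_sum_of_nonempty hne fun y _ => ?_))
    exact mul_lt_mul_of_pos_left
      (hfmono (hmem β hβ _ (hs β hβ).1 y) (hmem β' hβ' _ (hs β' hβ').1 y) (h y)) (hp y)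
  have hlip : ∀ β ∈ Set.Icc 0 b, ∀ β' ∈ Set.Icc 0 b, β ≤ β' →
      |s β' - s β| ≤ ℓ y₁ * (β' - β) := by
    intro β hβ β' hβ' hle
    rw [abs_le]
    constructor
    · by_contra hcon
      push Not at hcon
      refine hcmp β' hβ' β hβ fun y => ?_
      nlinarith [hℓ0 y, hℓ0 y₁]
    · by_contra hcon
      push Not at hcon
      refine hcmp β hβ β' hβ' fun y => ?_
      nlinarith [hy₁ y]
  have hscont : ContinuousOn s (Set.Icc 0 b) := by
    refine LipschitzOnWith.continuousOn (K := (ℓ y₁).toNNReal) ?_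
    refine LipschitzOnWith.of_dist_le_mul fun β hβ β' hβ' => ?_
    rw [Real.coe_toNNReal _ (hℓ0 y₁), Real.dist_eq, Real.dist_eq]
    rcases le_total β β' with h | h
    · rw [abs_sub_comm, abs_sub_comm β, abs_of_nonneg (sub_nonneg.2 h)]
      exact hlip β hβ β' hβ' h
    · rw [abs_of_nonneg (sub_nonneg.2 h)]
      exact hlip β' hβ' β hβ h
  set D : ℝ → ℝ := fun β =>
    E.v z RiskType.h - ∑ y, E.p RiskType.l y * f (s β - β * ℓ y) with hD
  have hDcont : ContinuousOn D (Set.Icc 0 b) := by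
    refine continuousOn_const.sub (continuousOn_finsetSum _ fun y _ => ?_)
    refine continuousOn_const.mul (hfc.comp_continuousOn ?_)
    exact hscont.sub (continuousOn_id.mul continuousOn_const)
  have h0 : (0 : ℝ) ∈ Set.Icc 0 b := ⟨le_rfl, hb.le⟩
  have hbb : b ∈ Set.Icc 0 b := ⟨hb.le, le_rfl⟩
  have hD0 : D 0 = 0 := by
    have h1 := (hs 0 h0).2
    simp only [zero_mul, sub_zero, ← Finset.sum_mul, E.p_sum, one_mul] at h1
    simp only [hD, zero_mul, sub_zero, ← Finset.sum_mul, E.p_sum, one_mul, h1, sub_self]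
  have hDb : D b = E.v z RiskType.h - E.v z RiskType.l := by
    -- At β = b the interval for s shrinks to the point a, so the path ends at z itself.
    have h1 : s b = a := by
      have := (hs b hbb).1
      simpa using this
    simp only [hD, h1, hfz]
  obtain ⟨β, hβ, hβd⟩ := intermediate_value_Icc hb.le hDcont (by rw [hD0, hDb]; exact hd)
  have hst : E.IsStationary (fun y => (G (s β - β * ℓ y)).toNNReal) (s β) β := by
    refine ⟨fun y => Real.toNNReal_pos.2 (hGpos _), fun y => ?_⟩
    rw [Real.coe_toNNReal _ (hGpos _).le, hGinv _ (hmem β hβ _ (hs β hβ).1 y), ← hpℓ]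
    ring
  have hv : ∀ θ, E.v (fun y => (G (s β - β * ℓ y)).toNNReal) θ =
      ∑ y, E.p θ y * f (s β - β * ℓ y) := fun θ => by
    simp only [v, hf, Real.coe_toNNReal _ (hGpos _).le]
  refine hst.hasInteriorSolution ?_ ?_
  · rw [hv, (hs β hβ).2]
  · rw [hv, ← hβd]
    simp only [hD]
    ring

/-- Under cost supermodularity, the marginal cost of flow utility at a distorted interior contract
exceeds that of any full insurance contract that gives the high type less utility. -/
theorem IsStationary.mc_lt {E : InsuranceModel Y Φ} {z : FlowContract Y} {a b : ℝ}
    (hz : E.IsStationary z a b) (hχ : E.CostSupermodular) (hp : ∀ y, 0 < E.p RiskType.h y)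
    (hb : 0 < b) {c : ℝ} (hc : 0 < c) (hcv : E.u c < E.v z RiskType.h) : E.mc c < a - b := by
  -- Full insurance at type `h`'s certainty equivalent c' links the two sides: mc c < mc c' = χ_ν(ν,
  -- 0), and χ_ν(ν, ·) is nondecreasing on [0, Δ], where interior solutions exist throughout.
  obtain ⟨c', hc', hc'v⟩ := E.exists_certainty_equivalent hz.pos RiskType.h
  refine (E.mc_lt_of_u_lt hc hc' (hc'v ▸ hcv)).trans_le ?_
  set ν := E.v z RiskType.h with hν
  set Δ := ν - E.v z RiskType.l with hΔ
  have hlt : E.v z RiskType.l < ν := E.v_lt_of_mc_eq hz.pos (by decide) hb hz.eq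
  have h1 := hz.χν_eq hν.symm (by rw [hΔ]; ring : E.v z RiskType.l = ν - Δ)
  have h2 := (E.isStationary_const hc').χν_eq (ν := ν) (Δ := 0)
    (by rw [E.v_const hc', hc'v]) (by rw [E.v_const hc', hc'v]; ring)
  have h3 : ∀ d ∈ Set.Icc 0 Δ, DifferentiableAt ℝ (fun d => E.χν ν d) d ∧
      0 ≤ deriv (fun d => E.χν ν d) d := fun d hd =>
    hχ ν d hd.1 (hz.hasInteriorSolution_of_le hp hb hd)
  have h4 : MonotoneOn (fun d => E.χν ν d) (Set.Icc 0 Δ) := by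
    refine monotoneOn_of_deriv_nonneg (convex_Icc 0 Δ)
      (fun d hd => (h3 d hd).1.continuousAt.continuousWithinAt) ?_ ?_
    · exact fun d hd => (h3 d (interior_subset hd)).1.differentiableWithinAt
    · exact fun d hd => (h3 d (interior_subset hd)).2
  have hΔ0 : 0 ≤ Δ := by linarith
  have h5 := h4 ⟨le_rfl, hΔ0⟩ ⟨hΔ0, le_rfl⟩ hΔ0
  simp only [h1, h2] at h5
  linarith

end InsuranceModel

/-! ### The branch after the report `h` as a cost minimization -/

/-- The type different from the given one. -/
def RiskType.other : RiskType → RiskType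
  | .l => .h
  | .h => .l

theorem RiskType.sum_eq {A : Type*} [AddCommMonoid A] (f : RiskType → A) :
    ∑ θ, f θ = f RiskType.l + f RiskType.h := by
  have : (Finset.univ : Finset RiskType) = {RiskType.l, RiskType.h} := rfl
  rw [this, Finset.sum_pair (by decide)]

/-- Farkas' lemma in coordinates. -/
theorem exists_nonneg_combination_of_coeff {K ι : Type*} [Fintype K] [DecidableEq K] [Fintype ι]
    (g : ι → K → ℝ) (f : K → ℝ)
    (H : ∀ d : K → ℝ, (∀ i, 0 ≤ ∑ k, g i k * d k) → 0 ≤ ∑ k, f k * d k) :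
    ∃ c : ι → ℝ, (∀ i, 0 ≤ c i) ∧ ∀ k, f k = ∑ i, c i * g i k := by
  let φ : (K → ℝ) → (K → ℝ) →ₗ[ℝ] ℝ := fun q => ∑ k, q k • LinearMap.proj k
  have hφ : ∀ q d, φ q d = ∑ k, q k * d k := fun q d => by simp [φ]
  obtain ⟨c, hc, hf⟩ := exists_nonneg_combination_of_nonneg Finset.univ (fun i => φ (g i)) (φ f)
    (fun d hd => by
      rw [hφ]
      exact H d fun i => by rw [← hφ]; exact hd i (Finset.mem_univ i))
  refine ⟨c, hc, fun k => ?_⟩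
  have := hf (Pi.single k 1)
  simpa [hφ, Pi.single_apply] using this

namespace InsuranceModel

variable {Y : Finset ℝ≥0} {Φ : Type*}

/-- Expected consumption cost of the flow contract `z` when provided to type `θ`. -/
noncomputable def costOf (E : InsuranceModel Y Φ) (z : FlowContract Y) (θ : RiskType) : ℝ :=
  ∑ y, E.p θ y * (z y : ℝ)

theorem ξ_eq (E : InsuranceModel Y Φ) (z : FlowContract Y) (θ : RiskType) :
    E.ξ z θ = ∑ y, E.p θ y * ((y : ℝ≥0) : ℝ) - E.costOf z θ := by
  simp only [ξ, costOf, mul_sub, Finset.sum_sub_distrib]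

/-- Perturbation of an interior flow contract in a direction of utility space. -/
theorem exists_line_perturbation (E : InsuranceModel Y Φ) {z : FlowContract Y}
    (hz : ∀ y, 0 < z y) (x : Y → ℝ) :
    ∃ ζ : ℝ → FlowContract Y, ζ 0 = z ∧
      (∀ᶠ t in 𝓝 (0 : ℝ), ∀ θ, E.v (ζ t) θ = E.v z θ + t * ∑ y, E.p θ y * x y) ∧
      ∀ θ, HasDerivAt (fun t => E.costOf (ζ t) θ) (∑ y, E.p θ y * E.mc (z y) * x y) 0 := by
  obtain ⟨ζ, hζ0, hζv, hζd⟩ := E.exists_perturbation hz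
  have hlin : HasDerivAt (fun t : ℝ => t • x) x 0 := by
    simpa using (hasDerivAt_id (0 : ℝ)).smul_const x
  have ht : Tendsto (fun t : ℝ => t • x) (𝓝 0) (𝓝 0) := by
    simpa using hlin.continuousAt.tendsto
  refine ⟨fun t => ζ (t • x), by simp [hζ0], ?_, fun θ => ?_⟩
  · filter_upwards [ht.eventually hζv] with t h θ
    rw [h θ, Finset.mul_sum]
    congr 1
    refine Finset.sum_congr rfl fun y _ => ?_
    simp only [Pi.smul_apply, smul_eq_mul]; ring
  · have h1 : ∀ y, HasDerivAt (fun t : ℝ => E.p θ y * (ζ (t • x) y : ℝ))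
        (E.p θ y * E.mc (z y) * x y) 0 := by
      intro y
      have h2 : HasFDerivAt (fun x => (ζ x y : ℝ))
        (E.mc (z y) • (ContinuousLinearMap.proj y : (Y → ℝ) →L[ℝ] ℝ)) ((0 : ℝ) • x) := by
        simpa using hζd y
      have h3 := (h2.comp_hasDerivAt (0 : ℝ) hlin).const_mul (E.p θ y)
      simpa [mul_assoc] using h3
    exact HasDerivAt.fun_sum fun y _ => h1 y

/-- An incentive compatible mechanism deters deviations of each initial type separately. -/
theorem IncentiveCompatible.payoffGiven_le {E : InsuranceModel Y Φ} {M : DirectMechanism Y Φ}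
    (hM : E.IncentiveCompatible M) (hprior : ∀ θ, 0 < E.prior θ) (r : ReportingStrategy Y)
    (θ : RiskType) : E.payoffGiven M r θ ≤ E.V₁ M θ := by
  let r' : ReportingStrategy Y :=
    { r₁ := fun θ₁ => if θ₁ = θ then r.r₁ θ₁ else θ₁
      r₂ := fun y i θ₁ j => if θ₁ = θ then r.r₂ y i θ₁ j else j }
  have h1 := hM r'
  have h2 : ∀ θ₁, E.payoffGiven M r' θ₁ =
      if θ₁ = θ then E.payoffGiven M r θ₁ else E.V₁ M θ₁ := by
    intro θ₁
    by_cases h : θ₁ = θ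
    · simp [payoffGiven, r', h]
    · simp [payoffGiven, r', h, V₁, ReportingStrategy.truthful]
  simp only [payoff, h2] at h1
  change _ ≤ ∑ θ₁, E.prior θ₁ * E.V₁ M θ₁ at h1
  rw [RiskType.sum_eq, RiskType.sum_eq] at h1
  cases θ <;> simp at h1
  · exact (mul_le_mul_iff_right₀ (hprior _)).1 h1
  · exact (mul_le_mul_iff_right₀ (hprior _)).1 h1

/-- An incentive compatible mechanism is incentive compatible in the second period after a truthful
report of the type `h`. -/
theorem IncentiveCompatible.second_period {E : InsuranceModel Y Φ} {M : DirectMechanism Y Φ}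
    (hM : E.IncentiveCompatible M) (hprior : ∀ θ, 0 < E.prior θ) (hp : ∀ y, 0 < E.p RiskType.h y)
    (htrans : ∀ j, 0 < E.trans RiskType.h j) (s : Φ) (j k : RiskType) :
    E.v (M.z₂ s RiskType.h k) j ≤ E.v (M.z₂ s RiskType.h j) j := by
  obtain ⟨y₀, rfl⟩ := E.φ_surjective s
  -- Misreporting at the single income y₀ and type j suffices: both have positive probability after
  -- type `h`, so a gain there would be a strict gain overall.
  let r : ReportingStrategy Y :=
    { r₁ := fun θ => θ
      r₂ := fun y _ _ i => if y = y₀ ∧ i = j then k else i }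
  have h1 := hM.payoffGiven_le hprior r RiskType.h
  simp only [V₁, payoffGiven, ReportingStrategy.truthful, r] at h1
  have h2 := le_of_mul_le_mul_left (le_of_add_le_add_left h1) E.δ_pos
  by_contra hcon
  push Not at hcon
  refine absurd h2 (not_le.2 ?_)
  have hterm : ∀ y i, E.trans RiskType.h i * E.v (M.z₂ (E.φ y) RiskType.h i) i ≤
      E.trans RiskType.h i *
        E.v (M.z₂ (E.φ y) RiskType.h (if y = y₀ ∧ i = j then k else i)) i := by
    intro y i
    refine mul_le_mul_of_nonneg_left ?_ (htrans i).le
    split_ifs with h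
    · obtain ⟨rfl, rfl⟩ := h
      exact hcon.le
    · exact le_rfl
  refine Finset.sum_lt_sum (fun y _ => mul_le_mul_of_nonneg_left
    (Finset.sum_le_sum fun i _ => hterm y i) (hp y).le) ⟨y₀, Finset.mem_univ _, ?_⟩
  refine mul_lt_mul_of_pos_left (Finset.sum_lt_sum (fun i _ => hterm y₀ i)
    ⟨j, Finset.mem_univ _, ?_⟩) (hp y₀)
  simp only [and_self, if_true]
  exact mul_lt_mul_of_pos_left hcon (htrans j)

theorem signalProb_nonneg [DecidableEq Φ] (E : InsuranceModel Y Φ) (θ : RiskType) (s : Φ) :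
    0 ≤ E.signalProb θ s :=
  Finset.sum_nonneg fun y _ => by split_ifs <;> simp [E.p_nonneg]

theorem signalProb_pos [DecidableEq Φ] (E : InsuranceModel Y Φ) {θ : RiskType} (hp : ∀ y, 0 < E.p θ y) (s : Φ) :
    0 < E.signalProb θ s := by
  obtain ⟨y, rfl⟩ := E.φ_surjective s
  refine Finset.sum_pos' (fun y _ => by split_ifs <;> simp [E.p_nonneg])
    ⟨y, Finset.mem_univ y, ?_⟩
  simp [hp]

section Signals

variable [Fintype Φ] [DecidableEq Φ]

theorem sum_signal (E : InsuranceModel Y Φ) (θ : RiskType) (F : Φ → ℝ) :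
    ∑ y, E.p θ y * F (E.φ y) = ∑ s, E.signalProb θ s * F s := by
  simp only [signalProb, Finset.sum_mul]
  rw [Finset.sum_comm]
  refine Finset.sum_congr rfl fun y _ => ?_
  simp

theorem signalProb_sum (E : InsuranceModel Y Φ) (θ : RiskType) : ∑ s, E.signalProb θ s = 1 := by
  have := E.sum_signal θ fun _ => 1
  simp only [mul_one, E.p_sum] at this
  exact this.symm

/-- Value to initial type `θ` of the contracts `a`, `b` offered after some first report, when the
second report is truthful. -/
noncomputable def branchValue (E : InsuranceModel Y Φ) (θ : RiskType) (a : FlowContract Y)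
    (b : Φ → RiskType → FlowContract Y) : ℝ :=
  E.v a θ + E.δ * ∑ s, E.signalProb θ s * ∑ j, E.trans θ j * E.v (b s j) j

/-- Consumption cost of the contracts `a`, `b` when provided to the initial type `h`. -/
noncomputable def branchCost (E : InsuranceModel Y Φ) (a : FlowContract Y)
    (b : Φ → RiskType → FlowContract Y) : ℝ :=
  E.costOf a RiskType.h +
    E.δ * ∑ s, E.signalProb RiskType.h s * ∑ j, E.trans RiskType.h j * E.costOf (b s j) j

theorem V₁_eq (E : InsuranceModel Y Φ) (M : DirectMechanism Y Φ) (θ : RiskType) :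
    E.V₁ M θ = E.branchValue θ (M.z₁ θ) (fun s => M.z₂ s θ) := by
  simp only [V₁, payoffGiven, ReportingStrategy.truthful, branchValue]
  rw [E.sum_signal θ fun s => ∑ j, E.trans θ j * E.v (M.z₂ s θ j) j]

/-- In an incentive compatible mechanism no type gains by a false first report followed
by truthful reports. -/
theorem IncentiveCompatible.branchValue_le {E : InsuranceModel Y Φ} {M : DirectMechanism Y Φ}
    (hM : E.IncentiveCompatible M) (hprior : ∀ θ, 0 < E.prior θ) (θ i : RiskType) :
    E.branchValue θ (M.z₁ i) (fun s => M.z₂ s i) ≤ E.V₁ M θ := by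
  refine le_of_eq_of_le ?_ (hM.payoffGiven_le hprior
    { r₁ := fun _ => i, r₂ := fun _ _ _ j => j } θ)
  simp only [payoffGiven, branchValue]
  rw [E.sum_signal θ fun s => ∑ j, E.trans θ j * E.v (M.z₂ s i j) j]

end Signals

/-- The mechanism obtained by replacing the contracts offered after the first report `h`. -/
def replaceHigh (M : DirectMechanism Y Φ) (a : FlowContract Y)
    (b : Φ → RiskType → FlowContract Y) : DirectMechanism Y Φ where
  z₁ := fun θ => match θ with
    | .l => M.z₁ .l
    | .h => a
  z₂ := fun s θ => match θ with
    | .l => M.z₂ s .l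
    | .h => b s

variable [Fintype Φ] [DecidableEq Φ]

/-- After a report `l` nothing has changed, so the old incentive constraints apply. After a report
`h`, truthful second reports are best for both initial types because `hb` holds signal by signal, so
`branchValue` bounds every deviation. -/
theorem Feasible.replaceHigh {E : InsuranceModel Y Φ} {V : RiskType → ℝ}
    {M : DirectMechanism Y Φ} (hM : E.Feasible V M) (hprior : ∀ θ, 0 < E.prior θ)
    {a : FlowContract Y} {b : Φ → RiskType → FlowContract Y}
    (hh : E.branchValue RiskType.h a b = V RiskType.h)
    (hl : E.branchValue RiskType.l a b ≤ V RiskType.l)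
    (hb : ∀ s j k, E.v (b s k) j ≤ E.v (b s j) j) :
    E.Feasible V (replaceHigh M a b) := by
  have hV : ∀ θ, E.V₁ (InsuranceModel.replaceHigh M a b) θ = V θ := by
    intro θ
    cases θ
    · rw [← hM.2, V₁_eq, V₁_eq]; rfl
    · rw [V₁_eq]; exact hh
  refine ⟨fun r => ?_, hV⟩
  refine Finset.sum_le_sum fun θ _ => mul_le_mul_of_nonneg_left ?_ (E.prior_nonneg θ)
  change _ ≤ E.V₁ _ θ
  rw [hV]
  cases hr : r.r₁ θ
  · have h1 : E.payoffGiven (InsuranceModel.replaceHigh M a b) r θ = E.payoffGiven M r θ := by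
      simp only [payoffGiven, hr, InsuranceModel.replaceHigh]
    rw [h1, ← hM.2]
    exact hM.1.payoffGiven_le hprior r θ
  · have h1 : E.payoffGiven (InsuranceModel.replaceHigh M a b) r θ ≤ E.branchValue θ a b := by
      simp only [payoffGiven, hr, InsuranceModel.replaceHigh, branchValue]
      rw [← E.sum_signal θ fun s => ∑ j, E.trans θ j * E.v (b s j) j]
      refine add_le_add_right (mul_le_mul_of_nonneg_left ?_ E.δ_pos.le) _
      refine Finset.sum_le_sum fun y _ => mul_le_mul_of_nonneg_left ?_ (E.p_nonneg θ y)
      exact Finset.sum_le_sum fun j _ => mul_le_mul_of_nonneg_left (hb _ j _) (E.trans_nonneg θ j)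
    refine h1.trans ?_
    cases θ
    · exact hl
    · exact hh.le

/-- Replacing the branch leaves the profit from type `l` and all expected incomes unchanged, so
comparing profits amounts to comparing branch costs. -/
theorem IsOptimal.branchCost_le {E : InsuranceModel Y Φ} {V : RiskType → ℝ}
    {M : DirectMechanism Y Φ} (hM : E.IsOptimal V M) (hprior : ∀ θ, 0 < E.prior θ)
    {a : FlowContract Y} {b : Φ → RiskType → FlowContract Y}
    (hh : E.branchValue RiskType.h a b = V RiskType.h)
    (hl : E.branchValue RiskType.l a b ≤ V RiskType.l)
    (hb : ∀ s j k, E.v (b s k) j ≤ E.v (b s j) j) :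
    E.branchCost (M.z₁ RiskType.h) (fun s => M.z₂ s RiskType.h) ≤ E.branchCost a b := by
  have h1 := hM.2 _ (hM.1.replaceHigh hprior hh hl hb)
  simp only [profit, RiskType.sum_eq, InsuranceModel.replaceHigh] at h1
  have h2 := (mul_le_mul_iff_right₀ (hprior RiskType.h)).1 (le_of_add_le_add_left h1)
  have h3 : ∀ (a : FlowContract Y) (b : Φ → RiskType → FlowContract Y),
      E.ξ a RiskType.h + E.δ * ∑ y, E.p RiskType.h y *
        (E.trans RiskType.h RiskType.l * E.ξ (b (E.φ y) RiskType.l) RiskType.l +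
          E.trans RiskType.h RiskType.h * E.ξ (b (E.φ y) RiskType.h) RiskType.h) =
      (∑ y, E.p RiskType.h y * ((y : ℝ≥0) : ℝ) + E.δ *
        (E.trans RiskType.h RiskType.l * (∑ y, E.p RiskType.l y * ((y : ℝ≥0) : ℝ)) +
          E.trans RiskType.h RiskType.h * (∑ y, E.p RiskType.h y * ((y : ℝ≥0) : ℝ)))) -
        E.branchCost a b := by
    intro a b
    rw [E.sum_signal RiskType.h fun s =>
      E.trans RiskType.h RiskType.l * E.ξ (b s RiskType.l) RiskType.l +
          E.trans RiskType.h RiskType.h * E.ξ (b s RiskType.h) RiskType.h]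
    simp only [branchCost, ξ_eq, RiskType.sum_eq]
    set kl := ∑ y, E.p RiskType.l y * ((y : ℝ≥0) : ℝ)
    set kh := ∑ y, E.p RiskType.h y * ((y : ℝ≥0) : ℝ)
    have h4 : ∀ s, E.signalProb RiskType.h s *
        (E.trans RiskType.h RiskType.l * (kl - E.costOf (b s RiskType.l) RiskType.l) +
          E.trans RiskType.h RiskType.h * (kh - E.costOf (b s RiskType.h) RiskType.h)) =
        E.signalProb RiskType.h s *
          (E.trans RiskType.h RiskType.l * kl + E.trans RiskType.h RiskType.h * kh) -
        E.signalProb RiskType.h s *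
          (E.trans RiskType.h RiskType.l * E.costOf (b s RiskType.l) RiskType.l +
            E.trans RiskType.h RiskType.h * E.costOf (b s RiskType.h) RiskType.h) :=
      fun s => by ring
    simp only [h4, Finset.sum_sub_distrib]
    rw [← Finset.sum_mul, E.signalProb_sum]
    ring
  rw [h3, h3 (M.z₁ RiskType.h) (fun s => M.z₂ s RiskType.h)] at h2
  linarith

end InsuranceModel

/-! ### Lagrange multipliers -/

namespace InsuranceModel

variable {Y : Finset ℝ≥0} {Φ : Type*} [Fintype Φ] [DecidableEq Φ]

/-- Coefficients of the value to type `θ` as a linear function of the utilities provided after the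
first report `h`. -/
noncomputable def valueCoeff (E : InsuranceModel Y Φ) (θ : RiskType) :
    Y ⊕ Φ × RiskType × Y → ℝ :=
  Sum.elim (E.p θ) fun q =>
    E.δ * (E.signalProb θ q.1 * (E.trans θ q.2.1 * E.p q.2.1 q.2.2))

/-- Coefficients of the gain from a truthful second report of type `i.2` at the signal `i.1`. -/
def gainCoeff (E : InsuranceModel Y Φ) (i : Φ × RiskType) : Y ⊕ Φ × RiskType × Y → ℝ :=
  Sum.elim (fun _ => 0) fun q =>
    if q.1 = i.1 then (if q.2.1 = i.2 then E.p i.2 q.2.2 else -E.p i.2 q.2.2) else 0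

/-- Marginal costs of the utilities provided after the first report `h`. -/
noncomputable def marginalCost (E : InsuranceModel Y Φ) (a : FlowContract Y)
    (b : Φ → RiskType → FlowContract Y) : Y ⊕ Φ × RiskType × Y → ℝ :=
  Sum.elim (fun y => E.mc (a y)) fun q => E.mc (b q.1 q.2.1 q.2.2)

theorem sum_valueCoeff (E : InsuranceModel Y Φ) (θ : RiskType) (d : Y ⊕ Φ × RiskType × Y → ℝ) :
    ∑ k, E.valueCoeff θ k * d k = ∑ y, E.p θ y * d (Sum.inl y) +
      E.δ * ∑ s, E.signalProb θ s * ∑ j, E.trans θ j * ∑ y, E.p j y * d (Sum.inr (s, j, y)) := by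
  simp only [valueCoeff, Fintype.sum_sum_type, Sum.elim_inl, Sum.elim_inr,
    Fintype.sum_prod_type, Finset.mul_sum, mul_assoc]

theorem sum_gainCoeff (E : InsuranceModel Y Φ) (s : Φ) (j : RiskType)
    (d : Y ⊕ Φ × RiskType × Y → ℝ) :
    ∑ k, E.gainCoeff (s, j) k * d k = ∑ y, E.p j y * d (Sum.inr (s, j, y)) -
      ∑ y, E.p j y * d (Sum.inr (s, j.other, y)) := by
  simp only [gainCoeff, Fintype.sum_sum_type, Sum.elim_inl, Sum.elim_inr,
    Fintype.sum_prod_type, ite_mul, zero_mul, Finset.sum_const_zero, zero_add]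
  rw [Finset.sum_eq_single s (fun s' _ h => by simp [h]) (by simp)]
  cases j <;> simp [RiskType.sum_eq, RiskType.other] <;> ring

/-- Lagrange multipliers for the contracts that an optimal mechanism offers after the first report
`h`: `lam` for the value of the high type, `μ` for the deviation of the low type, and `γ s j` for
the second-period incentive constraint of type `j` after the signal `s`. -/
theorem IsOptimal.exists_multipliers {E : InsuranceModel Y Φ} {V : RiskType → ℝ}
    {M : DirectMechanism Y Φ} (hM : E.IsOptimal V M) (hprior : ∀ θ, 0 < E.prior θ)
    (hp : ∀ y, 0 < E.p RiskType.h y) (htrans : ∀ j, 0 < E.trans RiskType.h j)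
    (hint₁ : ∀ y, 0 < M.z₁ RiskType.h y) (hint₂ : ∀ s θ y, 0 < M.z₂ s RiskType.h θ y) :
    ∃ (lam μ : ℝ) (γ : Φ → RiskType → ℝ), 0 ≤ μ ∧ (∀ s j, 0 ≤ γ s j) ∧
      (∀ s j, 0 < γ s j →
        E.v (M.z₂ s RiskType.h j) j = E.v (M.z₂ s RiskType.h j.other) j) ∧
      (∀ y, E.p RiskType.h y * E.mc (M.z₁ RiskType.h y) =
        lam * E.p RiskType.h y - μ * E.p RiskType.l y) ∧
      ∀ s j y, E.δ * E.signalProb RiskType.h s * E.trans RiskType.h j *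
          (E.p j y * E.mc (M.z₂ s RiskType.h j y)) =
        (lam * (E.δ * E.signalProb RiskType.h s * E.trans RiskType.h j) -
          μ * (E.δ * E.signalProb RiskType.l s * E.trans RiskType.l j) + γ s j) * E.p j y -
          γ s j.other * E.p j.other y := by
  classical
  set z₁ := M.z₁ RiskType.h with hz₁
  set z₂ : Φ → RiskType → FlowContract Y := fun s => M.z₂ s RiskType.h with hz₂
  have hPK : E.branchValue RiskType.h z₁ z₂ = V RiskType.h := by
    rw [← hM.1.2, V₁_eq]
  have hIC : E.branchValue RiskType.l z₁ z₂ ≤ V RiskType.l := by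
    rw [← hM.1.2]; exact hM.1.1.branchValue_le hprior _ _
  have hIC2 : ∀ s j k, E.v (z₂ s k) j ≤ E.v (z₂ s j) j :=
    hM.1.1.second_period hprior hp htrans
  let active : Φ × RiskType → Prop := fun i => E.v (z₂ i.1 i.2) i.2 = E.v (z₂ i.1 i.2.other) i.2
  -- The promise to type `h` is an equality and enters as two opposite inequalities. Second-period
  -- constraints with slack are replaced by the zero functional, which yields complementary
  -- slackness.
  let g : Option (Option (Option (Φ × RiskType))) → (Y ⊕ Φ × RiskType × Y) → ℝ
    | none => E.valueCoeff RiskType.h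
    | some none => fun k => -E.valueCoeff RiskType.h k
    | some (some none) => fun k => -E.valueCoeff RiskType.l k
    | some (some (some i)) => fun k => if active i then E.gainCoeff i k else 0
  obtain ⟨c, hc, hf⟩ := exists_nonneg_combination_of_coeff g
    (fun k => E.valueCoeff RiskType.h k * E.marginalCost z₁ z₂ k) (by
      intro d hd
      have hd0 : ∑ k, E.valueCoeff RiskType.h k * d k = 0 := by
        have h1 := hd none
        have h2 := hd (some none)
        simp only [g, neg_mul, Finset.sum_neg_distrib] at h1 h2
        linarith
      have hdl : ∑ k, E.valueCoeff RiskType.l k * d k ≤ 0 := by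
        have h1 := hd (some (some none))
        simp only [g, neg_mul, Finset.sum_neg_distrib] at h1
        linarith
      have hdg : ∀ s j, active (s, j) → 0 ≤ ∑ k, E.gainCoeff (s, j) k * d k := by
        intro s j h
        have h1 := hd (some (some (some (s, j))))
        simpa only [g, h, if_true] using h1
      -- Along these curves utilities are exactly affine for small t, so every direction satisfying
      -- the linear constraints is truly feasible and no constraint qualification is needed.
      obtain ⟨ζ₁, hζ₁0, hζ₁v, hζ₁d⟩ := E.exists_line_perturbation hint₁ fun y => d (Sum.inl y)
      choose ζ₂ hζ₂0 hζ₂v hζ₂d using fun s j =>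
        E.exists_line_perturbation (hint₂ s j) fun y => d (Sum.inr (s, j, y))
      have hζ₂v' := eventually_all.2 fun s => eventually_all.2 fun j => hζ₂v s j
      have hder : HasDerivAt (fun t => E.branchCost (ζ₁ t) fun s j => ζ₂ s j t)
          (∑ k, E.valueCoeff RiskType.h k * (E.marginalCost z₁ z₂ k * d k)) 0 := by
        rw [sum_valueCoeff]
        simp only [branchCost, marginalCost, Sum.elim_inl, Sum.elim_inr, ← mul_assoc]
        refine (hζ₁d RiskType.h).add (HasDerivAt.const_mul _ ?_)
        refine HasDerivAt.fun_sum fun s _ => HasDerivAt.const_mul _ ?_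
        exact HasDerivAt.fun_sum fun j _ => (hζ₂d s j j).const_mul _
      simp only [mul_assoc]
      refine hder.nonneg_of_eventually_le_right ?_
      have hval : ∀ᶠ t in 𝓝 (0 : ℝ), ∀ θ, E.branchValue θ (ζ₁ t) (fun s j => ζ₂ s j t) =
          E.branchValue θ z₁ z₂ + t * ∑ k, E.valueCoeff θ k * d k := by
        filter_upwards [hζ₁v, hζ₂v'] with t h1 h2 θ
        rw [sum_valueCoeff]
        simp only [branchValue, h1, h2, mul_add, Finset.sum_add_distrib]
        have h3 : ∑ s, E.signalProb θ s * ∑ j, E.trans θ j *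
            (t * ∑ y, E.p j y * d (Sum.inr (s, j, y))) =
            t * ∑ s, E.signalProb θ s * ∑ j, E.trans θ j *
              ∑ y, E.p j y * d (Sum.inr (s, j, y)) := by
          simp only [Finset.mul_sum]
          refine Finset.sum_congr rfl fun s _ => Finset.sum_congr rfl fun j _ =>
            Finset.sum_congr rfl fun y _ => by ring
        rw [h3]
        ring
      have hgain : ∀ᶠ t in 𝓝[>] (0 : ℝ), ∀ s j, E.v (ζ₂ s j.other t) j ≤ E.v (ζ₂ s j t) j := by
        refine eventually_all.2 fun s => eventually_all.2 fun j => ?_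
        have h1 : ∀ᶠ t in 𝓝[>] (0 : ℝ), 0 ≤ E.v (z₂ s j) j - E.v (z₂ s j.other) j +
            t * ∑ k, E.gainCoeff (s, j) k * d k := by
          by_cases h : active (s, j)
          · filter_upwards [self_mem_nhdsWithin] with t ht
            have h2 : E.v (z₂ s j) j = E.v (z₂ s j.other) j := h
            rw [h2, sub_self, zero_add]
            exact mul_nonneg (le_of_lt ht) (hdg s j h)
          · have h2 : 0 < E.v (z₂ s j) j - E.v (z₂ s j.other) j :=
              sub_pos.2 (lt_of_le_of_ne (hIC2 s j j.other) fun h3 => h h3.symm)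
            have h3 : Continuous fun t : ℝ => E.v (z₂ s j) j - E.v (z₂ s j.other) j +
              t * ∑ k, E.gainCoeff (s, j) k * d k := by fun_prop
            have h4 := h3.tendsto 0
            rw [zero_mul, add_zero] at h4
            exact ((h4.eventually (lt_mem_nhds h2)).mono fun _ => le_of_lt).filter_mono
              nhdsWithin_le_nhds
        filter_upwards [h1, hζ₂v'.filter_mono nhdsWithin_le_nhds] with t h2 h3
        rw [sum_gainCoeff] at h2
        rw [h3, h3]
        linarith
      filter_upwards [hval.filter_mono nhdsWithin_le_nhds, hgain, self_mem_nhdsWithin]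
        with t h1 h2 ht
      have ht : 0 < t := ht
      have h3 : (fun s j => ζ₂ s j 0) = z₂ := by
        funext s j; exact hζ₂0 s j
      rw [zero_add, hζ₁0, h3]
      refine hM.branchCost_le hprior ?_ ?_ ?_
      · rw [h1, hd0, mul_zero, add_zero, hPK]
      · rw [h1]
        nlinarith
      · intro s j k
        by_cases hjk : k = j
        · rw [hjk]
        · have : k = j.other := by cases j <;> cases k <;> simp_all [RiskType.other]
          rw [this]
          exact h2 s j)
  simp only [Fintype.sum_option, g, mul_ite, mul_zero] at hf
  let m : Φ × RiskType → ℝ := fun i => if active i then c (some (some (some i))) else 0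
  refine ⟨c none - c (some none), c (some (some none)), fun s j => m (s, j), hc _, fun s j => ?_,
    fun s j h => ?_, fun y => ?_, fun s j y => ?_⟩
  · dsimp only [m]
    split_ifs
    exacts [hc _, le_rfl]
  · by_contra hcon
    have hna : ¬ active (s, j) := hcon
    simp only [m, hna, if_false, lt_irrefl] at h
  · have h1 := hf (Sum.inl y)
    simp only [valueCoeff, marginalCost, gainCoeff, Sum.elim_inl, mul_zero, ite_self,
      Finset.sum_const_zero] at h1
    rw [h1]; ring
  · have h1 := hf (Sum.inr (s, j, y))
    have h2 : ∀ i : Φ × RiskType, (if active i then c (some (some (some i))) *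
        E.gainCoeff i (Sum.inr (s, j, y)) else 0) = m i * E.gainCoeff i (Sum.inr (s, j, y)) :=
      fun i => by by_cases h : active i <;> simp [m, h]
    simp only [h2] at h1
    rw [Fintype.sum_prod_type, Finset.sum_eq_single s
      (fun s' _ h => by simp [gainCoeff, Ne.symm h]) (by simp)] at h1
    simp only [valueCoeff, marginalCost, gainCoeff, Sum.elim_inr, RiskType.sum_eq, if_true] at h1
    have h3 : E.δ * E.signalProb RiskType.h s * E.trans RiskType.h j *
          (E.p j y * E.mc (z₂ s j y)) =
        E.δ * (E.signalProb RiskType.h s * (E.trans RiskType.h j * E.p j y)) *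
          E.mc (z₂ s j y) := by ring
    refine h3.trans (h1.trans ?_)
    cases j <;> simp only [RiskType.other, reduceCtorEq, if_true, if_false] <;> ring

end InsuranceModel

/-! ### Second-period contracts -/

namespace InsuranceModel

variable {Y : Finset ℝ≥0} {Φ : Type*}

theorem trans_l (E : InsuranceModel Y Φ) (i : RiskType) :
    E.trans i RiskType.l = 1 - E.trans i RiskType.h := by
  have := E.trans_sum i
  rw [RiskType.sum_eq] at this
  linarith

theorem v_le_v (E : InsuranceModel Y Φ) {z z' : FlowContract Y} {θ : RiskType}
    (h : ∀ y, 0 < E.p θ y → E.u (z y) ≤ E.u (z' y)) : E.v z θ ≤ E.v z' θ := by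
  refine Finset.sum_le_sum fun y _ => ?_
  rcases (E.p_nonneg θ y).lt_or_eq with hy | hy
  · exact mul_le_mul_of_nonneg_left (h y hy) hy.le
  · simp [← hy]

theorem exists_p_pos (E : InsuranceModel Y Φ) (θ : RiskType) : ∃ y, 0 < E.p θ y := by
  by_contra! h
  have h1 : ∑ y, E.p θ y ≤ 0 := Finset.sum_nonpos fun y _ => h y
  rw [E.p_sum] at h1
  linarith

theorem v_lt_v (E : InsuranceModel Y Φ) {z z' : FlowContract Y} {θ : RiskType}
    (h : ∀ y, 0 < E.p θ y → E.u (z y) < E.u (z' y)) : E.v z θ < E.v z' θ := by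
  obtain ⟨y₀, hy₀⟩ := E.exists_p_pos θ
  refine Finset.sum_lt_sum (fun y _ => ?_)
    ⟨y₀, Finset.mem_univ _, mul_lt_mul_of_pos_left (h y₀ hy₀) hy₀⟩
  rcases (E.p_nonneg θ y).lt_or_eq with hy | hy
  · exact mul_le_mul_of_nonneg_left (h y hy).le hy.le
  · simp [← hy]

/-- A contract with constant marginal cost of utility on the support of type `θ` provides full
insurance to this type. -/
theorem v_eq_of_mc_eq (E : InsuranceModel Y Φ) {z : FlowContract Y} (hz : ∀ y, 0 < z y)
    {θ : RiskType} {c : ℝ} (hc : 0 < c) (h : ∀ y, 0 < E.p θ y → E.mc (z y) = E.mc c) :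
    E.v z θ = E.u c := by
  rw [← E.v_const hc θ]
  have h1 : ∀ y, 0 < E.p θ y → (z y : ℝ) = c := fun y hy =>
    E.mc_strictMonoOn.injOn (NNReal.coe_pos.2 (hz y)) hc (h y hy)
  refine le_antisymm (E.v_le_v fun y hy => ?_) (E.v_le_v fun y hy => ?_) <;>
    simp [h1 y hy, hc.le]

theorem branchValue_eq_of_forall_eq [Fintype Φ] [DecidableEq Φ] (E : InsuranceModel Y Φ)
    {θ : RiskType} {a : FlowContract Y} {b : Φ → RiskType → FlowContract Y} {w : ℝ}
    (ha : E.v a θ = w) (hb : ∀ s j, E.v (b s j) j = w) :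
    E.branchValue θ a b = w + E.δ * w := by
  simp only [branchValue, ha, hb, ← Finset.sum_mul, E.trans_sum, E.signalProb_sum, one_mul]

/-- The first-order conditions in the second period, at a signal of probability `P` for type `h`
and `Q` for type `l`, with multipliers `α` and `β` of the incentive constraints of the types `l`
and `h`. -/
structure SecondPeriodConditions (E : InsuranceModel Y Φ) (zh zl : FlowContract Y)
    (lam μ P Q α β : ℝ) : Prop where
  pos_h : ∀ y, 0 < zh y
  pos_l : ∀ y, 0 < zl y
  nonneg_α : 0 ≤ α
  nonneg_β : 0 ≤ β
  slack_α : 0 < α → E.v zl RiskType.l = E.v zh RiskType.l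
  slack_β : 0 < β → E.v zh RiskType.h = E.v zl RiskType.h
  eq_h : ∀ y, E.δ * P * E.trans RiskType.h RiskType.h * (E.p RiskType.h y * E.mc (zh y)) =
    (lam * (E.δ * P * E.trans RiskType.h RiskType.h) -
      μ * (E.δ * Q * E.trans RiskType.l RiskType.h) + β) * E.p RiskType.h y -
      α * E.p RiskType.l y
  eq_l : ∀ y, E.δ * P * E.trans RiskType.h RiskType.l * (E.p RiskType.l y * E.mc (zl y)) =
    (lam * (E.δ * P * E.trans RiskType.h RiskType.l) -
      μ * (E.δ * Q * E.trans RiskType.l RiskType.l) + α) * E.p RiskType.l y -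
      β * E.p RiskType.h y

namespace SecondPeriodConditions

variable {E : InsuranceModel Y Φ} {zh zl : FlowContract Y} {lam μ P Q α β : ℝ}

/-- The incentive constraint of the high type has a zero multiplier. -/
theorem β_eq_zero (H : E.SecondPeriodConditions zh zl lam μ P Q α β)
    (hp : ∀ y, 0 < E.p RiskType.h y) (hhl : 0 < E.trans RiskType.h RiskType.l)
    (hμ : 0 ≤ μ) (hP : 0 < P) (hQ : 0 ≤ Q) : β = 0 := by
  have hhh : 0 < E.trans RiskType.h RiskType.h :=
    (E.trans_nonneg _ _).trans_lt (E.persistent RiskType.h RiskType.l (by decide))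
  have hδ := E.δ_pos
  by_contra hne
  have hβ : 0 < β := lt_of_le_of_ne H.nonneg_β (Ne.symm hne)
  have hbind := H.slack_β hβ
  set wh := E.δ * P * E.trans RiskType.h RiskType.h with hwh
  set wl := E.δ * P * E.trans RiskType.h RiskType.l with hwl
  have hwh0 : 0 < wh := by positivity
  have hwl0 : 0 < wl := by positivity
  rcases H.nonneg_α.lt_or_eq with hα | hα
  -- If both constraints bind, each contract is strictly worse for the other type, and the chain
  -- v(zh,h) = v(zl,h) < v(zl,l) = v(zh,l) < v(zh,h) is absurd.
  · have h1 : E.v zh RiskType.l < E.v zh RiskType.h := by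
      refine E.v_lt_of_mc_eq H.pos_h (by decide) (div_pos hα hwh0)
        (a := (lam * wh - μ * (E.δ * Q * E.trans RiskType.l RiskType.h) + β) / wh) fun y => ?_
      have := H.eq_h y
      field_simp
      linarith
    have h2 : E.v zl RiskType.h < E.v zl RiskType.l := by
      refine E.v_lt_of_mc_eq H.pos_l (by decide) (div_pos hβ hwl0)
        (a := (lam * wl - μ * (E.δ * Q * E.trans RiskType.l RiskType.l) + α) / wl) fun y => ?_
      have := H.eq_l y
      field_simp
      linarith
    have h3 := H.slack_α hα
    linarith
  -- With α = 0 the contract `zh` has constant marginal cost. Persistence of types puts it above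
  -- that of `zl` at every income, so type `h` strictly prefers `zh`.
  · refine absurd hbind (ne_of_gt (E.v_lt_v fun y _ => ?_))
    refine E.u_lt_of_mc_lt (NNReal.coe_pos.2 (H.pos_l y)) (NNReal.coe_pos.2 (H.pos_h y)) ?_
    have hpy := hp y
    have e1 := H.eq_h y
    have e2 := H.eq_l y
    rw [← hα] at e1 e2
    have hpl : 0 < E.p RiskType.l y := by
      refine lt_of_le_of_ne (E.p_nonneg _ y) fun h => ?_
      rw [← h] at e2
      simp only [zero_mul, mul_zero, zero_sub] at e2
      have := mul_pos hβ hpy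
      linarith
    have k1 : wh * E.mc (zh y) =
        lam * wh - μ * (E.δ * Q * E.trans RiskType.l RiskType.h) + β := by
      refine mul_right_cancel₀ hpy.ne' ?_
      linarith
    have k2 : wl * E.mc (zl y) <
        lam * wl - μ * (E.δ * Q * E.trans RiskType.l RiskType.l) := by
      refine lt_of_mul_lt_mul_right ?_ hpl.le
      have := mul_pos hβ hpy
      linarith
    have k3 := mul_lt_mul_of_pos_left k2 hhh
    have k5 : 0 ≤ μ * (E.δ * Q) * (E.trans RiskType.h RiskType.h - E.trans RiskType.l RiskType.h) :=
      mul_nonneg (by positivity)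
        (sub_nonneg.2 (E.persistent RiskType.h RiskType.l (by decide)).le)
    have k6 : 0 < E.trans RiskType.h RiskType.l * β := mul_pos hhl hβ
    have k7 : E.trans RiskType.h RiskType.h * wl = E.trans RiskType.h RiskType.l * wh := by
      rw [hwh, hwl]; ring
    have k8 : E.trans RiskType.h RiskType.h * E.trans RiskType.l RiskType.l -
        E.trans RiskType.h RiskType.l * E.trans RiskType.l RiskType.h =
        E.trans RiskType.h RiskType.h - E.trans RiskType.l RiskType.h := by
      rw [E.trans_l, E.trans_l]; ring
    have k9 : E.trans RiskType.h RiskType.l * wh * E.mc (zl y) <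
        E.trans RiskType.h RiskType.l * wh * E.mc (zh y) := by
      rw [← k8] at k5
      linear_combination k3 + k5 + k6 - E.trans RiskType.h RiskType.l * k1 +
        (lam - E.mc (zl y)) * k7
    exact lt_of_mul_lt_mul_left k9 (by positivity)

/-- The low type is fully insured in the second period. -/
theorem exists_consumption (H : E.SecondPeriodConditions zh zl lam μ P Q α 0)
    (hhl : 0 < E.trans RiskType.h RiskType.l) (hP : 0 < P) :
    ∃ c : ℝ, 0 < c ∧ E.v zl RiskType.l = E.u c ∧
      E.δ * P * E.trans RiskType.h RiskType.l * E.mc c =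
        lam * (E.δ * P * E.trans RiskType.h RiskType.l) -
          μ * (E.δ * Q * E.trans RiskType.l RiskType.l) + α := by
  have hδ := E.δ_pos
  have hw : 0 < E.δ * P * E.trans RiskType.h RiskType.l := by positivity
  have h1 : ∀ y, 0 < E.p RiskType.l y → E.δ * P * E.trans RiskType.h RiskType.l * E.mc (zl y) =
      lam * (E.δ * P * E.trans RiskType.h RiskType.l) -
          μ * (E.δ * Q * E.trans RiskType.l RiskType.l) + α := fun y hy => by
    refine mul_right_cancel₀ hy.ne' ?_
    linarith [H.eq_l y]
  obtain ⟨y₀, hy₀⟩ := E.exists_p_pos RiskType.l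
  refine ⟨zl y₀, NNReal.coe_pos.2 (H.pos_l y₀), ?_, h1 y₀ hy₀⟩
  refine E.v_eq_of_mc_eq H.pos_l (NNReal.coe_pos.2 (H.pos_l y₀)) fun y hy => ?_
  refine mul_left_cancel₀ hw.ne' ?_
  rw [h1 y hy, h1 y₀ hy₀]

theorem isStationary (H : E.SecondPeriodConditions zh zl lam μ P Q α 0)
    (hhh : 0 < E.trans RiskType.h RiskType.h) (hP : 0 < P) :
    E.IsStationary zh
      (lam - μ * (Q * E.trans RiskType.l RiskType.h) / (P * E.trans RiskType.h RiskType.h))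
      (α / (E.δ * P * E.trans RiskType.h RiskType.h)) := by
  refine ⟨H.pos_h, fun y => ?_⟩
  have hδ := E.δ_pos
  have := H.eq_h y
  field_simp
  linarith

/-- Without a cost of deterring the low type in the first period, both types are fully insured in
the second period, at the same consumption level. -/
theorem of_μ_eq_zero (H : E.SecondPeriodConditions zh zl lam 0 P Q α 0)
    (hp : ∀ y, 0 < E.p RiskType.h y) (hhh : 0 < E.trans RiskType.h RiskType.h)
    (hhl : 0 < E.trans RiskType.h RiskType.l) (hP : 0 < P) {c : ℝ} (hc : 0 < c)
    (hlam : E.mc c = lam) : E.v zh RiskType.h = E.u c ∧ E.v zl RiskType.l = E.u c := by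
  have hδ := E.δ_pos
  have hwh : 0 < E.δ * P * E.trans RiskType.h RiskType.h := by positivity
  have hwl : 0 < E.δ * P * E.trans RiskType.h RiskType.l := by positivity
  obtain ⟨c', hc', hv, hmc⟩ := H.exists_consumption hhl hP
  rcases H.nonneg_α.lt_or_eq with hα | hα
  -- A positive α pushes the marginal cost of type `l`'s consumption above lam while that of `zh` is
  -- at most lam everywhere, so type `l`'s constraint would be slack.
  · exfalso
    have h1 := H.slack_α hα
    have h2 : lam < E.mc c' := by
      refine lt_of_mul_lt_mul_left ?_ hwl.le
      rw [hmc]; linarith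
    have h3 : E.v zh RiskType.l < E.v (fun _ => c'.toNNReal) RiskType.l := by
      refine E.v_lt_v fun y _ => ?_
      rw [Real.coe_toNNReal _ hc'.le]
      refine E.u_lt_of_mc_lt (NNReal.coe_pos.2 (H.pos_h y)) hc' (lt_of_le_of_lt ?_ h2)
      refine le_of_mul_le_mul_left ?_ (mul_pos hwh (hp y))
      have := mul_nonneg hα.le (E.p_nonneg RiskType.l y)
      linarith [H.eq_h y]
    rw [E.v_const hc'] at h3
    linarith
  · subst hα
    constructor
    · refine E.v_eq_of_mc_eq H.pos_h hc fun y hy => ?_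
      rw [hlam]
      refine mul_left_cancel₀ (mul_pos hwh hy).ne' ?_
      linarith [H.eq_h y]
    · have h1 : E.mc c' = E.mc c := by
        rw [hlam]
        refine mul_left_cancel₀ hwl.ne' ?_
        linarith
      rw [hv, E.mc_strictMonoOn.injOn hc' hc h1]

/-- Bound on the multiplier of the low type's incentive constraint in the second period, implied by
cost supermodularity. -/
theorem α_lt (H : E.SecondPeriodConditions zh zl lam μ P Q α 0) (hχ : E.CostSupermodular)
    (hp : ∀ y, 0 < E.p RiskType.h y) (hhh : 0 < E.trans RiskType.h RiskType.h)
    (hhl : 0 < E.trans RiskType.h RiskType.l) (hP : 0 < P) (hα : 0 < α) :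
    α < μ * E.δ * (E.trans RiskType.h RiskType.h - E.trans RiskType.l RiskType.h) * Q := by
  have hδ := E.δ_pos
  obtain ⟨c, hc, hv, hmc⟩ := H.exists_consumption hhl hP
  have hst := H.isStationary hhh hP
  have hb : 0 < α / (E.δ * P * E.trans RiskType.h RiskType.h) := by positivity
  -- The binding constraint gives u(c) = v(zh,l) < v(zh,h), so `IsStationary.mc_lt` applies.
  -- Clearing denominators in mc c < χ_ν is exactly the bound.
  have h1 : E.u c < E.v zh RiskType.h := by
    rw [← hv, H.slack_α hα]
    exact E.v_lt_of_mc_eq H.pos_h (by decide) hb hst.eq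
  have h2 := hst.mc_lt hχ hp hb hc h1
  have hw : 0 < E.δ * P * E.trans RiskType.h RiskType.l * E.trans RiskType.h RiskType.h := by
    positivity
  have h3 := mul_lt_mul_of_pos_left h2 hw
  have h4 : E.δ * P * E.trans RiskType.h RiskType.l * E.trans RiskType.h RiskType.h *
      (lam - μ * (Q * E.trans RiskType.l RiskType.h) / (P * E.trans RiskType.h RiskType.h) -
        α / (E.δ * P * E.trans RiskType.h RiskType.h)) =
      lam * (E.δ * P * E.trans RiskType.h RiskType.l * E.trans RiskType.h RiskType.h) -
        μ * (E.δ * Q * E.trans RiskType.l RiskType.h) * E.trans RiskType.h RiskType.l -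
        α * E.trans RiskType.h RiskType.l := by
    field_simp
  rw [h4] at h3
  linear_combination h3 - E.trans RiskType.h RiskType.h * hmc +
    μ * E.δ * Q * (E.trans RiskType.h RiskType.h * E.trans_l RiskType.l -
      E.trans RiskType.l RiskType.h * E.trans_l RiskType.h) - α * E.trans_l RiskType.h

end SecondPeriodConditions

end InsuranceModel

/-! ### The main theorem -/

theorem mainTheorem8 {Y : Finset ℝ≥0} {Φ : Type*} [Fintype Φ] [DecidableEq Φ]
    (E : InsuranceModel Y Φ)
    (hp : ∀ y, 0 < E.p RiskType.h y)
    (hprior : ∀ θ, 0 < E.prior θ)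
    (htrans : 0 < E.trans RiskType.h RiskType.l)
    (hχ : E.CostSupermodular)
    (V : RiskType → ℝ) (hV : V RiskType.l < V RiskType.h)
    (M : DirectMechanism Y Φ) (hM : E.IsOptimal V M)
    (hint₁ : ∀ y, 0 < M.z₁ RiskType.h y)
    (hint₂ : ∀ s θ y, 0 < M.z₂ s RiskType.h θ y) :
    -- the marginal costs below are genuine derivatives
    (DifferentiableAt ℝ (fun q : ℝ × ℝ => E.χ q.1 q.2) (E.ν₁ M, E.Δ₁ M) ∧
      (∀ s, DifferentiableAt ℝ (fun q : ℝ × ℝ => E.χ q.1 q.2) (E.ν₂ M s, E.Δ₂ M s)) ∧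
      (∀ s, DifferentiableAt ℝ (fun q : ℝ × ℝ => E.χ q.1 q.2) (E.ν₂l M s, 0))) ∧
    -- the marginal cost of distortion falls in expectation
    E.χΔ (E.ν₁ M) (E.Δ₁ M) >
      ∑ s, E.signalProb RiskType.h s * E.χΔ (E.ν₂ M s) (E.Δ₂ M s) ∧
    -- the marginal cost of flow utility rises after `h` and falls after `l`, in expectation
    ∑ s, E.signalProb RiskType.h s * E.χν (E.ν₂ M s) (E.Δ₂ M s) > E.χν (E.ν₁ M) (E.Δ₁ M) ∧
    E.χν (E.ν₁ M) (E.Δ₁ M) > ∑ s, E.signalProb RiskType.h s * E.χν (E.ν₂l M s) 0 := by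
  have hδ := E.δ_pos
  have hgap := E.persistent RiskType.h RiskType.l (by decide)
  have hlh := E.trans_nonneg RiskType.l RiskType.h
  have hhh : 0 < E.trans RiskType.h RiskType.h := hlh.trans_lt hgap
  have hP : ∀ s, 0 < E.signalProb RiskType.h s := E.signalProb_pos hp
  have hQ : ∀ s, 0 ≤ E.signalProb RiskType.l s := E.signalProb_nonneg _
  obtain ⟨lam, μ, γ, hμ, hγ, hslack, heq₁, heq₂⟩ := hM.exists_multipliers hprior hp
    (fun j => by cases j <;> assumption) hint₁ hint₂
  have hβ : ∀ s, E.SecondPeriodConditions (M.z₂ s RiskType.h RiskType.h)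
      (M.z₂ s RiskType.h RiskType.l) lam μ (E.signalProb RiskType.h s) (E.signalProb RiskType.l s)
      (γ s RiskType.l) (γ s RiskType.h) := fun s =>
    { pos_h := hint₂ s _
      pos_l := hint₂ s _
      nonneg_α := hγ s _
      nonneg_β := hγ s _
      slack_α := hslack s RiskType.l
      slack_β := hslack s RiskType.h
      eq_h := heq₂ s RiskType.h
      eq_l := heq₂ s RiskType.l }
  have H : ∀ s, E.SecondPeriodConditions (M.z₂ s RiskType.h RiskType.h)
      (M.z₂ s RiskType.h RiskType.l) lam μ (E.signalProb RiskType.h s) (E.signalProb RiskType.l s)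
      (γ s RiskType.l) 0 := fun s => by
    have h1 := hβ s
    rwa [h1.β_eq_zero hp htrans hμ (hP s) (hQ s)] at h1
  have hμ : 0 < μ := by
    refine lt_of_le_of_ne hμ fun h0 => ?_
    subst h0
    obtain ⟨y₀, -⟩ := E.exists_p_pos RiskType.h
    have hc : (0 : ℝ) < M.z₁ RiskType.h y₀ := NNReal.coe_pos.2 (hint₁ y₀)
    have hmc : ∀ y, E.mc (M.z₁ RiskType.h y) = lam := fun y => by
      refine mul_left_cancel₀ (hp y).ne' ?_
      linarith [heq₁ y]
    have h1 : ∀ θ, E.v (M.z₁ RiskType.h) θ = E.u (M.z₁ RiskType.h y₀) := fun θ =>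
      E.v_eq_of_mc_eq hint₁ hc fun y _ => by rw [hmc, hmc]
    have h2 : ∀ s j, E.v (M.z₂ s RiskType.h j) j = E.u (M.z₁ RiskType.h y₀) := fun s j => by
      have := (H s).of_μ_eq_zero hp hhh htrans (hP s) hc (hmc y₀)
      cases j
      exacts [this.2, this.1]
    have h3 := hM.1.1.branchValue_le hprior RiskType.l RiskType.h
    rw [hM.1.2, E.branchValue_eq_of_forall_eq (h1 _) h2] at h3
    have h4 := hM.1.2 RiskType.h
    rw [InsuranceModel.V₁_eq, E.branchValue_eq_of_forall_eq (h1 _) h2] at h4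
    linarith
  have hst₁ : E.IsStationary (M.z₁ RiskType.h) lam μ := ⟨hint₁, heq₁⟩
  have hst₂ := fun s => (H s).isStationary hhh (hP s)
  choose c hc hcv hcmc using fun s => (H s).exists_consumption htrans (hP s)
  have hν₁ : E.v (M.z₁ RiskType.h) RiskType.l = E.ν₁ M - E.Δ₁ M := by simp [InsuranceModel.Δ₁]
  have hν₂ : ∀ s, E.v (M.z₂ s RiskType.h RiskType.h) RiskType.l = E.ν₂ M s - E.Δ₂ M s :=
    fun s => by simp [InsuranceModel.Δ₂]
  have hc1 : ∀ s, E.v (fun _ => (c s).toNNReal) RiskType.h = E.ν₂l M s := fun s => by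
    rw [E.v_const (hc s), ← hcv]; rfl
  have hc2 : ∀ s, E.v (fun _ => (c s).toNNReal) RiskType.l = E.ν₂l M s - 0 := fun s => by
    rw [E.v_const (hc s), ← hcv, sub_zero]; rfl
  set S := ∑ s, γ s RiskType.l with hS
  -- Signals with zero multiplier satisfy the bound weakly. Strictness of the sum comes from a
  -- signal that type `l` sends with positive probability, whether or not its multiplier vanishes.
  have hbound : S < μ * E.δ * (E.trans RiskType.h RiskType.h - E.trans RiskType.l RiskType.h) := by
    rw [← mul_one (μ * E.δ * _), ← E.signalProb_sum RiskType.l, Finset.mul_sum]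
    have hk : 0 < μ * E.δ * (E.trans RiskType.h RiskType.h - E.trans RiskType.l RiskType.h) :=
      mul_pos (mul_pos hμ hδ) (sub_pos.2 hgap)
    obtain ⟨s₀, hs₀⟩ : ∃ s, 0 < E.signalProb RiskType.l s := by
      by_contra! h
      have h1 : ∑ s, E.signalProb RiskType.l s ≤ 0 := Finset.sum_nonpos fun s _ => h s
      rw [E.signalProb_sum] at h1
      linarith
    have hlt := fun s => (H s).α_lt hχ hp hhh htrans (hP s)
    refine Finset.sum_lt_sum (fun s _ => ?_) ⟨s₀, Finset.mem_univ _, ?_⟩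
    · rcases (hγ s RiskType.l).lt_or_eq with h | h
      · exact (hlt s h).le
      · rw [← h]; exact mul_nonneg hk.le (hQ s)
    · rcases (hγ s₀ RiskType.l).lt_or_eq with h | h
      · exact hlt s₀ h
      · rw [← h]; exact mul_pos hk hs₀
  refine ⟨⟨(hst₁.hasFDerivAt_χ rfl hν₁).differentiableAt,
    fun s => ((hst₂ s).hasFDerivAt_χ rfl (hν₂ s)).differentiableAt,
    fun s => ((E.isStationary_const (hc s)).hasFDerivAt_χ (hc1 s) (hc2 s)).differentiableAt⟩, ?_⟩
  have e1 : E.χΔ (E.ν₁ M) (E.Δ₁ M) = μ := hst₁.χΔ_eq rfl hν₁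
  have e2 : E.χν (E.ν₁ M) (E.Δ₁ M) = lam - μ := hst₁.χν_eq rfl hν₁
  have e3 : ∑ s, E.signalProb RiskType.h s * E.χΔ (E.ν₂ M s) (E.Δ₂ M s) =
      S / (E.δ * E.trans RiskType.h RiskType.h) := by
    rw [hS, Finset.sum_div]
    refine Finset.sum_congr rfl fun s _ => ?_
    rw [(hst₂ s).χΔ_eq (ν := E.ν₂ M s) rfl (hν₂ s)]
    have := hP s
    field_simp
  have e4 : ∑ s, E.signalProb RiskType.h s * E.χν (E.ν₂ M s) (E.Δ₂ M s) =
      lam - μ * E.trans RiskType.l RiskType.h / E.trans RiskType.h RiskType.h -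
        S / (E.δ * E.trans RiskType.h RiskType.h) := by
    have h1 : ∀ s, E.signalProb RiskType.h s * E.χν (E.ν₂ M s) (E.Δ₂ M s) =
        E.signalProb RiskType.h s * lam - E.signalProb RiskType.l s *
          (μ * E.trans RiskType.l RiskType.h / E.trans RiskType.h RiskType.h) -
          γ s RiskType.l / (E.δ * E.trans RiskType.h RiskType.h) := fun s => by
      rw [(hst₂ s).χν_eq (ν := E.ν₂ M s) rfl (hν₂ s)]
      have := hP s
      field_simp
    simp only [h1, Finset.sum_sub_distrib, ← Finset.sum_mul, E.signalProb_sum, one_mul,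
      ← Finset.sum_div, hS]
  have e5 : ∑ s, E.signalProb RiskType.h s * E.χν (E.ν₂l M s) 0 =
      lam - μ * E.trans RiskType.l RiskType.l / E.trans RiskType.h RiskType.l +
        S / (E.δ * E.trans RiskType.h RiskType.l) := by
    have h1 : ∀ s, E.signalProb RiskType.h s * E.χν (E.ν₂l M s) 0 =
        E.signalProb RiskType.h s * lam - E.signalProb RiskType.l s *
          (μ * E.trans RiskType.l RiskType.l / E.trans RiskType.h RiskType.l) +
          γ s RiskType.l / (E.δ * E.trans RiskType.h RiskType.l) := fun s => by
      rw [(E.isStationary_const (hc s)).χν_eq (hc1 s) (hc2 s), sub_zero]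
      have := hP s
      field_simp
      linarith [hcmc s]
    simp only [h1, Finset.sum_add_distrib, Finset.sum_sub_distrib, ← Finset.sum_mul,
      E.signalProb_sum, one_mul, ← Finset.sum_div, hS]
  -- `f1` and `f2` are `hbound` divided by δ π_hh and by δ π_hl. The first gives the rise of χ_ν
  -- after `h` and, dropping a nonnegative term, the fall of χ_Δ; the second gives the fall of χ_ν
  -- after `l`.
  have f1 : S / (E.δ * E.trans RiskType.h RiskType.h) <
      μ - μ * E.trans RiskType.l RiskType.h / E.trans RiskType.h RiskType.h := by
    rw [div_lt_iff₀ (by positivity)]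
    refine hbound.trans_eq ?_
    field_simp
  have f2 : S / (E.δ * E.trans RiskType.h RiskType.l) <
      μ * E.trans RiskType.l RiskType.l / E.trans RiskType.h RiskType.l - μ := by
    rw [div_lt_iff₀ (by positivity)]
    refine hbound.trans_eq ?_
    field_simp
    rw [E.trans_l, E.trans_l]
    ring
  have f3 : 0 ≤ μ * E.trans RiskType.l RiskType.h / E.trans RiskType.h RiskType.h := by positivity
  rw [e1, e2, e3, e4, e5]
  refine ⟨?_, ?_, ?_⟩ <;> linarith
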